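/- All rings are commutative and Noetherian and all modules are finitely generated. Let $(A,\mathfrak m)$ be a regular local ring of dimension $d>0$ and let $M\neq 0$ be a finitely generated $A$-module with $\dim M<d$. Let $R=A\ltimes M$ be the idealization of $M$, that is, $A\oplus M$ with the multiplication $(a,u)(b,v)=(ab,\,av+bu)$. Then $R$ is a Noetherian local ring with maximal ideal $\mathfrak n=\mathfrak m\oplus M$, $\dim R=d$, and $\operatorname{depth} R=\min\{\operatorname{depth} M,\operatorname{depth} A\}<d$; in particular $R$ is not Cohen--Macaulay. Nevertheless, let $G=G_{\mathfrak n}(R)=\bigoplus_{n\ge 0}\mathfrak n^n/\mathfrak n^{n+1}$ be the associated graded ring, let $G_+=\bigoplus_{n\ge 1}\mathfrak n^n/\mathfrak n^{n+1}$, and let $a(G)=\max\{n\in\mathbb Z : H^{\dim R}_{G_+}(G)_n\neq 0\}$ be its $a$-invariant, where $H^i_{G_+}(G)_n$ is the degree $n$ part of the graded local cohomology module. Then this maximum exists and $a(G_{\mathfrak n}(R))=-d=-\dim R$. -/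

import Mathlib

open scoped DirectSum

/-! ### Depth and Cohen-Macaulay local rings -/

/-- The depth of a module over a local ring: the supremum of the lengths of the `M`-regular
sequences contained in the maximal ideal. -/
noncomputable def moduleDepth (R : Type*) [CommRing R] [IsLocalRing R]
    (M : Type*) [AddCommGroup M] [Module R M] : ℕ∞ :=
  ⨆ (rs : List R) (_ : (∀ r ∈ rs, r ∈ IsLocalRing.maximalIdeal R) ∧
    RingTheory.Sequence.IsRegular M rs), (rs.length : ℕ∞)

/-- A local ring is Cohen-Macaulay if it is Noetherian and its depth is its Krull dimension. -/
def IsCohenMacaulayLocal (R : Type*) [CommRing R] [IsLocalRing R] : Prop :=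
  IsNoetherianRing R ∧ ((moduleDepth R R : ℕ∞) : WithBot ℕ∞) = ringKrullDim R

/-! ### The associated graded ring `G_I(R) = ⨁ I ^ n / I ^ (n + 1)` -/

namespace AssocGraded

variable {R : Type*} [CommRing R] (I : Ideal R)

/-- The component `I ^ n / I ^ (n + 1)`. -/
abbrev Piece (n : ℕ) : Type _ := ↥(I ^ n) ⧸ (I ^ (n + 1)).submoduleOf (I ^ n)

/-- The class of an element of `I ^ n` in `I ^ n / I ^ (n + 1)`. -/
def mk (n : ℕ) (a : R) (ha : a ∈ I ^ n) : Piece I n :=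
  Submodule.Quotient.mk ⟨a, ha⟩

/-- The product of the elements of `I ^ i` and `I ^ j`, with values in `I ^ (i + j)`. -/
def powMul (i j : ℕ) : ↥(I ^ i) →ₗ[R] ↥(I ^ j) →ₗ[R] ↥(I ^ (i + j)) :=
  LinearMap.mk₂ R (fun a b => ⟨a.1 * b.1, by rw [pow_add]; exact Ideal.mul_mem_mul a.2 b.2⟩)
    (fun a b c => Subtype.ext (add_mul _ _ _))
    (fun r a b => Subtype.ext (mul_assoc _ _ _))
    (fun a b c => Subtype.ext (mul_add _ _ _))
    (fun r a b => Subtype.ext (mul_left_comm _ _ _))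

/-- The product `I ^ i / I ^ (i + 1) × I ^ j / I ^ (j + 1) → I ^ (i + j) / I ^ (i + j + 1)`. -/
def pieceMul (i j : ℕ) : Piece I i →ₗ[R] Piece I j →ₗ[R] Piece I (i + j) :=
  Submodule.liftQ _
    (LinearMap.flip (Submodule.liftQ _
      (LinearMap.flip ((powMul I i j).compr₂ (Submodule.mkQ _)))
      (by
        intro b hb
        ext a
        refine (Submodule.Quotient.mk_eq_zero _).2 ?_
        change (a : R) * (b : R) ∈ I ^ (i + j + 1)
        rw [add_assoc, pow_add]
        exact Ideal.mul_mem_mul a.2 hb)))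
    (by
      intro a ha
      ext b
      refine (Submodule.Quotient.mk_eq_zero _).2 ?_
      change (a : R) * (b : R) ∈ I ^ (i + j + 1)
      rw [add_right_comm, pow_add]
      exact Ideal.mul_mem_mul ha b.2)

theorem pieceMul_mk {i j : ℕ} (a b : R) (ha : a ∈ I ^ i) (hb : b ∈ I ^ j) :
    pieceMul I i j (mk I i a ha) (mk I j b hb) =
      mk I (i + j) (a * b) (by rw [pow_add]; exact Ideal.mul_mem_mul ha hb) := rfl

theorem exists_mk {n : ℕ} (z : Piece I n) : ∃ a ha, z = mk I n a ha := by
  obtain ⟨⟨a, ha⟩, rfl⟩ := Submodule.Quotient.mk_surjective _ z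
  exact ⟨a, ha, rfl⟩

theorem mk_sigma {i j : ℕ} (hij : i = j) {a b : R} (hab : a = b) (ha : a ∈ I ^ i)
    (hb : b ∈ I ^ j) :
    (GradedMonoid.mk i (mk I i a ha) : GradedMonoid (Piece I)) =
      GradedMonoid.mk j (mk I j b hb) := by
  subst hij hab; rfl

instance : GradedMonoid.GMul (Piece I) where
  mul {i j} a b := pieceMul I i j a b

instance : GradedMonoid.GOne (Piece I) where
  one := mk I 0 1 (by simp)

instance : DirectSum.GCommRing (Piece I) where
  mul_zero a := map_zero _
  zero_mul b := by
    change pieceMul I _ _ 0 b = 0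
    simp
  mul_add a b c := map_add _ _ _
  add_mul a b c := by
    change pieceMul I _ _ (a + b) c = pieceMul I _ _ a c + pieceMul I _ _ b c
    simp
  one_mul := by
    rintro ⟨i, z⟩
    obtain ⟨a, ha, rfl⟩ := exists_mk I z
    exact mk_sigma I (zero_add i) (one_mul a) _ _
  mul_one := by
    rintro ⟨i, z⟩
    obtain ⟨a, ha, rfl⟩ := exists_mk I z
    exact mk_sigma I (add_zero i) (mul_one a) _ _
  mul_assoc := by
    rintro ⟨i, z⟩ ⟨j, w⟩ ⟨k, v⟩
    obtain ⟨a, ha, rfl⟩ := exists_mk I z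
    obtain ⟨b, hb, rfl⟩ := exists_mk I w
    obtain ⟨c, hc, rfl⟩ := exists_mk I v
    exact mk_sigma I (add_assoc i j k) (mul_assoc a b c) _ _
  mul_comm := by
    rintro ⟨i, z⟩ ⟨j, w⟩
    obtain ⟨a, ha, rfl⟩ := exists_mk I z
    obtain ⟨b, hb, rfl⟩ := exists_mk I w
    exact mk_sigma I (add_comm i j) (mul_comm a b) _ _
  natCast n := mk I 0 n (by simp)
  natCast_zero := congrArg (Submodule.Quotient.mk) (Subtype.ext Nat.cast_zero)
  natCast_succ n := congrArg (Submodule.Quotient.mk) (Subtype.ext (Nat.cast_succ n))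
  intCast n := mk I 0 n (by simp)
  intCast_ofNat n := congrArg (Submodule.Quotient.mk) (Subtype.ext (Int.cast_natCast n))
  intCast_negSucc_ofNat n := congrArg (Submodule.Quotient.mk) (Subtype.ext (Int.cast_negSucc n))

end AssocGraded

/-- The associated graded ring `G_I(R) = ⨁ I ^ n / I ^ (n + 1)`; its multiplication is the one
induced by the multiplication of `R`. -/
abbrev AssocGradedRing {R : Type*} [CommRing R] (I : Ideal R) : Type _ :=
  ⨁ n : ℕ, AssocGraded.Piece I n

/-- The homogeneous elements of degree `n` of `G_I(R)`. -/
def AssocGraded.component {R : Type*} [CommRing R] (I : Ideal R) (n : ℕ) :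
    AddSubgroup (AssocGradedRing I) :=
  (DirectSum.of (AssocGraded.Piece I) n).range

/-! ### Graded local cohomology through the Čech complex

`S` is a commutative ring with homogeneous components `𝒜 n`, and `x` is a finite family of
homogeneous elements, `x j` being of degree `e j`. -/

namespace Cech

variable {S : Type*} [CommRing S] (𝒜 : ℕ → AddSubgroup S)

/-- The ideal `S₊` generated by the homogeneous elements of positive degree. -/
def irrelevantIdeal : Ideal S :=
  Ideal.span {a | ∃ n : ℕ, 0 < n ∧ a ∈ 𝒜 n}

variable {s : ℕ} (x : Fin s → S) (e : Fin s → ℕ)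

/-- The localization of `S` at the product of the `x j` with `j ∈ J`. -/
abbrev Loc (J : Finset (Fin s)) : Type _ := Localization.Away (∏ j ∈ J, x j)

/-- The homogeneous elements of degree `n` of the localization: the fractions `a / x_J ^ k` with
`a` homogeneous of degree `n + k * deg x_J`. (They form a subgroup already if the `x j` are
homogeneous of degree `e j` and `S` is graded.) -/
def locDegree (J : Finset (Fin s)) (n : ℤ) : AddSubgroup (Loc x J) :=
  AddSubgroup.closure {z | ∃ (k m : ℕ) (a : S), a ∈ 𝒜 m ∧
    (m : ℤ) = n + k * (∑ j ∈ J, e j : ℕ) ∧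
    z = Localization.mk a ⟨(∏ j ∈ J, x j) ^ k, pow_mem (Submonoid.mem_powers _) k⟩}

theorem isUnit_prod {I J : Finset (Fin s)} (h : I ⊆ J) :
    IsUnit (algebraMap S (Loc x J) (∏ j ∈ I, x j)) :=
  isUnit_of_dvd_unit (map_dvd _ (Finset.prod_dvd_prod_of_subset I J x h))
    (IsLocalization.Away.algebraMap_isUnit _)

/-- The localization map `S_{x_I} → S_{x_J}` for `I ⊆ J`. -/
noncomputable def res {I J : Finset (Fin s)} (h : I ⊆ J) : Loc x I →+* Loc x J :=
  IsLocalization.Away.lift (∏ j ∈ I, x j) (isUnit_prod x h)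

/-- The direct sum of all the terms of the Čech complex. -/
abbrev Total : Type _ := (J : Finset (Fin s)) → Loc x J

/-- The Čech differential,
`(d c)_J = ∑ j ∈ J, (-1) ^ #{i ∈ J | i < j} • c_{J \ {j}}|_J`. -/
noncomputable def differential : Total x →+ Total x where
  toFun c J := ∑ j ∈ J, (-1 : ℤ) ^ (J.filter (· < j)).card •
    res x (J.erase_subset j) (c (J.erase j))
  map_zero' := by funext J; simp
  map_add' c c' := by funext J; simp [Finset.sum_add_distrib]

/-- The degree `n` part of the `i`-th term `⨁_{#J = i} S_{x_J}` of the Čech complex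
(zero for negative `i`). -/
def cochains (i n : ℤ) : AddSubgroup (Total x) where
  carrier := {c | ∀ J, c J ∈ locDegree 𝒜 x e J n ∧ ((J.card : ℤ) ≠ i → c J = 0)}
  zero_mem' J := ⟨zero_mem _, fun _ => rfl⟩
  add_mem' ha hb J := ⟨add_mem (ha J).1 (hb J).1, fun h => by
    rw [Pi.add_apply, (ha J).2 h, (hb J).2 h, add_zero]⟩
  neg_mem' ha J := ⟨neg_mem (ha J).1, fun h => by
    rw [Pi.neg_apply, (ha J).2 h, neg_zero]⟩

/-- The cocycles of degree `n` in the `i`-th term. -/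
noncomputable def cocycles (i n : ℤ) : AddSubgroup (Total x) :=
  cochains 𝒜 x e i n ⊓ (differential x).ker

/-- The coboundaries of degree `n` in the `i`-th term. -/
noncomputable def coboundaries (i n : ℤ) : AddSubgroup (Total x) :=
  (cochains 𝒜 x e (i - 1) n).map (differential x)

/-- The degree `n` part `H^i_{(x)}(S)_n` of the `i`-th local cohomology module of `S` with
support in the ideal generated by the family `x`. -/
abbrev Cohomology (i n : ℤ) : Type _ :=
  ↥(cocycles 𝒜 x e i n) ⧸ (coboundaries 𝒜 x e i n).addSubgroupOf (cocycles 𝒜 x e i n)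

end Cech

/-- `a = max {n | H^r_{S₊}(S)_n ≠ 0}`. Local cohomology is that of the Čech complex of a finite
family of homogeneous generators of `S₊`; such a family has to exist, and the statement is made
for all of them. -/
def IsTopDegreeLocalCohomology {S : Type*} [CommRing S] (𝒜 : ℕ → AddSubgroup S)
    (r : ℕ) (a : ℤ) : Prop :=
  (∃ (s : ℕ) (x : Fin s → S) (e : Fin s → ℕ), (∀ j, x j ∈ 𝒜 (e j)) ∧
    Ideal.span (Set.range x) = Cech.irrelevantIdeal 𝒜) ∧
  ∀ (s : ℕ) (x : Fin s → S) (e : Fin s → ℕ), (∀ j, x j ∈ 𝒜 (e j)) →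
    Ideal.span (Set.range x) = Cech.irrelevantIdeal 𝒜 →
    IsGreatest {n : ℤ | Nontrivial (Cech.Cohomology 𝒜 x e r n)} a

/-- `a` is the `a`-invariant of the associated graded ring `G = G_I(R)`, that is
`a = max {n | H^r_{G₊}(G)_n ≠ 0}` where `r = dim R`. -/
def IsAInvariant {R : Type*} [CommRing R] (I : Ideal R) (a : ℤ) : Prop :=
  ∃ r : ℕ, ringKrullDim R = r ∧
    IsTopDegreeLocalCohomology (S := AssocGradedRing I) (AssocGraded.component I) r a

/-! Let `R = A ⋉ M` and let `k` be the residue field of `A`. The projection `R → A` induces a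
surjection `G(R) → G(A)` (`gradedFst`). Its target is a polynomial ring `k[X_1, …, X_d]`, since a
regular system of parameters is quasi-regular: a form whose value lies in the next power of the
ideal has its coefficients in the ideal (`coeff_mem_of_eval_mem_pow_succ`).

The kernel `N` is spanned additively by forms of elements `(0, u)`. Two of these multiply to zero,
so `N` is killed by itself and `G(R) / Ann N` is a quotient of `k[X]`. As `dim M < dim A`, some `a ≠
0` annihilates `M`; its initial form annihilates `N` and has nonzero image in the domain `k[X]`.
Hence `dim N < d` (`supportDim_ker_gradedFst_lt`), both `H^d(N)` and `H^{d+1}(N)` vanish, and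
`H^d(G(R)) ≅ H^d(k[X])` degree by degree. The top degree of the latter is `-d`, by induction on `d`
along `0 → P(-1) → P → P / X_0 P → 0` (`polyProj_cohomology`).

Cohomology is computed by the Čech complex of an arbitrary finite homogeneous family generating
`G₊`. By Nakayama, the images in `G(A)` of its members of degree one include the initial forms of a
regular system of parameters (`exists_forms_of_generators`); presenting `G(A)` by these very
parameters turns the chosen generators into the variables. The long exact sequence is replaced by
chases on Čech cochains of modules. A grading enters only through projections compatible with the
generators (`Proj`), and `Proj.Vanish i n` expresses `H^i(W)_n = 0`. Vanishing above the dimension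
is ungraded and comes from a prime filtration.

The statements on depth come from `0 → M → R → A → 0`: `depth M ≤ dim M < d = depth A`, and the
`Ext` sequence of the residue field shows that the middle term inherits the smaller depth. -/

/-! ### Fractions with denominators the powers of one element -/

namespace AwayModule

variable {S : Type*} [CommRing S] {y : S} {W T : Type*} [AddCommGroup W] [Module S W]
  [AddCommGroup T]

variable (y W) in
/-- The localization of a module at the powers of `y`. -/
def Away : Type _ := LocalizedModule (Submonoid.powers y) W

noncomputable instance : AddCommGroup (Away y W) :=
  inferInstanceAs (AddCommGroup (LocalizedModule (Submonoid.powers y) W))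

noncomputable instance : Module S (Away y W) :=
  inferInstanceAs (Module S (LocalizedModule (Submonoid.powers y) W))

variable (y) in
/-- The fraction `w / y ^ k`. -/
def frac (w : W) (k : ℕ) : Away y W :=
  (LocalizedModule.mk w ⟨y ^ k, pow_mem (Submonoid.mem_powers y) k⟩ :
    LocalizedModule (Submonoid.powers y) W)

theorem exists_frac (z : Away y W) : ∃ w k, z = frac y w k := by
  refine LocalizedModule.induction_on (β := fun z => ∃ w k, z = frac y w k) ?_ z
  rintro w ⟨t, k, rfl⟩
  exact ⟨w, k, rfl⟩

theorem frac_eq_frac {w w' : W} {k k' : ℕ} :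
    frac y w k = frac y w' k' ↔ ∃ l : ℕ, y ^ (l + k') • w = y ^ (l + k) • w' := by
  refine LocalizedModule.mk_eq.trans ?_
  constructor
  · rintro ⟨⟨u, l, rfl⟩, h⟩
    refine ⟨l, ?_⟩
    simpa [Submonoid.smul_def, smul_smul, pow_add] using h
  · rintro ⟨l, h⟩
    refine ⟨⟨y ^ l, l, rfl⟩, ?_⟩
    simpa [Submonoid.smul_def, smul_smul, pow_add] using h

theorem frac_eq_zero {w : W} {k : ℕ} : frac y w k = 0 ↔ ∃ l : ℕ, y ^ l • w = 0 := by
  have h0 : (0 : Away y W) = frac y 0 0 := (LocalizedModule.zero_mk _).symm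
  rw [h0, frac_eq_frac]
  simp

@[simp] theorem frac_zero (k : ℕ) : frac y (0 : W) k = 0 := LocalizedModule.zero_mk _

theorem frac_pow_smul (w : W) (k l : ℕ) : frac y (y ^ l • w) (k + l) = frac y w k :=
  frac_eq_frac.2 ⟨0, by simp [smul_smul, pow_add]⟩

theorem frac_smul_succ (w : W) (k : ℕ) : frac y (y • w) (k + 1) = frac y w k := by
  simpa using frac_pow_smul w k 1

theorem frac_add (w w' : W) (k : ℕ) : frac y (w + w') k = frac y w k + frac y w' k := by
  refine Eq.trans ?_ LocalizedModule.mk_add_mk.symm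
  refine LocalizedModule.mk_eq.2 ⟨1, ?_⟩
  simp [Submonoid.smul_def, smul_smul]

theorem smul_frac (r : S) (w : W) (k : ℕ) : r • frac y w k = frac y (r • w) k :=
  LocalizedModule.smul'_mk _ _ _

theorem exists_frac₂ (z z' : Away y W) : ∃ w w' k, z = frac y w k ∧ z' = frac y w' k := by
  obtain ⟨w, k, rfl⟩ := exists_frac z
  obtain ⟨w', k', rfl⟩ := exists_frac z'
  refine ⟨y ^ k' • w, y ^ k • w', k + k', (frac_pow_smul _ _ _).symm, ?_⟩
  rw [add_comm, frac_pow_smul]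

/-- Additive maps `φ k` on `W`, to be thought of as `w ↦ φ (w / y ^ k)`, induce an additive map on
the localization. -/
noncomputable def lift (φ : ℕ → W →+ T) (hφ : ∀ k w, φ (k + 1) (y • w) = φ k w) :
    Away y W →+ T :=
  have hl : ∀ l k w, φ (k + l) (y ^ l • w) = φ k w := by
    intro l
    induction l with
    | zero => simp
    | succ l ih =>
      intro k w
      rw [pow_succ', mul_smul, ← add_assoc, hφ, ih]
  have key : ∀ w w' k k', frac y w k = frac y w' k' → φ k w = φ k' w' := by
    intro w w' k k' h
    obtain ⟨l, hl'⟩ := frac_eq_frac.1 h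
    rw [← hl (l + k') k w, hl', ← hl (l + k) k' w']
    congr 2
    omega
  have hc : ∀ z : Away y W, z = frac y (exists_frac z).choose (exists_frac z).choose_spec.choose :=
    fun z => (exists_frac z).choose_spec.choose_spec
  AddMonoidHom.mk' (fun z => φ (exists_frac z).choose_spec.choose (exists_frac z).choose) (by
    intro z z'
    obtain ⟨w, w', k, hz, hz'⟩ := exists_frac₂ z z'
    rw [key _ w _ k ((hc z).symm.trans hz), key _ w' _ k ((hc z').symm.trans hz'), ← map_add]
    refine key _ _ _ _ ((hc _).symm.trans ?_)
    rw [frac_add, ← hz, ← hz'])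

theorem lift_frac (φ : ℕ → W →+ T) (hφ : ∀ k w, φ (k + 1) (y • w) = φ k w) (w : W) (k : ℕ) :
    lift φ hφ (frac y w k) = φ k w := by
  have hl : ∀ l k w, φ (k + l) (y ^ l • w) = φ k w := by
    intro l
    induction l with
    | zero => simp
    | succ l ih =>
      intro k w
      rw [pow_succ', mul_smul, ← add_assoc, hφ, ih]
  have h := (exists_frac (frac y w k)).choose_spec.choose_spec
  obtain ⟨l, hl'⟩ := frac_eq_frac.1 h
  change φ (exists_frac (frac y w k)).choose_spec.choose (exists_frac (frac y w k)).choose = _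
  generalize (exists_frac (frac y w k)).choose_spec.choose = k' at *
  generalize (exists_frac (frac y w k)).choose = w' at *
  rw [← hl (l + k') k w, hl', ← hl (l + k) k' w']
  congr 2
  omega

/-- `w ↦ w / y ^ k` as an additive map. -/
noncomputable def fracHom (y : S) (k : ℕ) : W →+ Away y W :=
  AddMonoidHom.mk' (frac y · k) (frac_add · · k)

@[simp] theorem fracHom_apply (k : ℕ) (w : W) : fracHom y k w = frac y w k := rfl

end AwayModule

/-! ### The Čech complex of a module -/

namespace Cech

open AwayModule

variable {S : Type*} [CommRing S] {s : ℕ} (x : Fin s → S)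

/-- The localization of a module at the product of the `x j` with `j ∈ J`. -/
abbrev MLoc (W : Type*) [AddCommGroup W] [Module S W] (J : Finset (Fin s)) : Type _ :=
  Away (∏ j ∈ J, x j) W

/-- The direct sum of all the terms of the Čech complex of a module. -/
abbrev MTotal (W : Type*) [AddCommGroup W] [Module S W] : Type _ :=
  (J : Finset (Fin s)) → MLoc x W J

section Differential

variable {W : Type*} [AddCommGroup W] [Module S W]

/-- The localization map `W_{x_I} → W_{x_J}` for `I ⊆ J`. -/
noncomputable def mres {I J : Finset (Fin s)} (h : I ⊆ J) : MLoc x W I →+ MLoc x W J :=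
  -- Since `x_J = x_{J \ I} x_I`, the fraction `w / x_I ^ k` equals `x_{J \ I} ^ k w / x_J ^ k`; the
  -- exponent of the denominator is kept.
  lift (fun k => (fracHom (∏ j ∈ J, x j) k).comp
      (DistribSMul.toAddMonoidHom W ((∏ j ∈ J \ I, x j) ^ k))) (by
    intro k w
    simp only [AddMonoidHom.comp_apply, DistribSMul.toAddMonoidHom_apply, fracHom_apply]
    rw [← frac_smul_succ ((∏ j ∈ J \ I, x j) ^ k • w), smul_smul, smul_smul]
    congr 2
    rw [← Finset.prod_sdiff h]
    ring)

theorem mres_frac {I J : Finset (Fin s)} (h : I ⊆ J) (w : W) (k : ℕ) :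
    mres x h (frac _ w k) = frac _ ((∏ j ∈ J \ I, x j) ^ k • w) k :=
  lift_frac _ _ _ _

theorem mres_smul {I J : Finset (Fin s)} (h : I ⊆ J) (r : S) (z : MLoc x W I) :
    mres x h (r • z) = r • mres x h z := by
  obtain ⟨w, k, rfl⟩ := exists_frac z
  rw [smul_frac, mres_frac, mres_frac, smul_frac, smul_comm]

theorem mres_mres {I J K : Finset (Fin s)} (h : I ⊆ J) (h' : J ⊆ K) (z : MLoc x W I) :
    mres x h' (mres x h z) = mres x (h.trans h') z := by
  obtain ⟨w, k, rfl⟩ := exists_frac z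
  rw [mres_frac, mres_frac, mres_frac, smul_smul, ← mul_pow]
  congr 3
  rw [← Finset.prod_sdiff (Finset.sdiff_subset_sdiff h' (le_refl I) : J \ I ⊆ K \ I)]
  congr 2
  ext a
  simp only [Finset.mem_sdiff]
  have := @h a
  tauto

theorem mres_congr {I I' J : Finset (Fin s)} (hI : I = I') (h : I ⊆ J) (h' : I' ⊆ J)
    (c : MTotal x W) : mres x h (c I) = mres x h' (c I') := by
  subst hI; rfl

/-- The Čech differential of a module. -/
noncomputable def mdiff : MTotal x W →+ MTotal x W where
  toFun c J := ∑ j ∈ J, (-1 : ℤ) ^ (J.filter (· < j)).card •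
    mres x (J.erase_subset j) (c (J.erase j))
  map_zero' := by funext J; simp
  map_add' c c' := by funext J; simp [Finset.sum_add_distrib]

theorem mdiff_apply (c : MTotal x W) (J : Finset (Fin s)) :
    mdiff x c J = ∑ j ∈ J, (-1 : ℤ) ^ (J.filter (· < j)).card •
      mres x (J.erase_subset j) (c (J.erase j)) := rfl

theorem mdiff_smul (r : S) (c : MTotal x W) : mdiff x (r • c) = r • mdiff x c := by
  funext J
  simp only [mdiff_apply, Pi.smul_apply, mres_smul, Finset.smul_sum]
  exact Finset.sum_congr rfl fun j _ => smul_comm _ _ _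

theorem card_filter_erase (J : Finset (Fin s)) {i j : Fin s} (hi : i ∈ J) (hij : i < j) :
    ((J.erase i).filter (· < j)).card + 1 = (J.filter (· < j)).card := by
  rw [Finset.filter_erase, Finset.card_erase_add_one]
  simp [hi, hij]

theorem card_filter_erase_of_le (J : Finset (Fin s)) {i j : Fin s} (hij : j ≤ i) :
    ((J.erase i).filter (· < j)).card = (J.filter (· < j)).card := by
  rw [Finset.filter_erase, Finset.erase_eq_of_notMem]
  simp [hij]

/-- Two indices can be removed in either order with the same restriction. The signs are opposite:
removing the smaller index lowers the sign exponent of the larger one by one, and not conversely. So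
the double sum cancels under exchange of the two indices. -/
theorem mdiff_mdiff (c : MTotal x W) : mdiff x (mdiff x c) = 0 := by
  funext J
  simp only [mdiff_apply, map_sum, map_zsmul, mres_mres, Finset.smul_sum, smul_smul, Pi.zero_apply]
  rw [Finset.sum_sigma']
  refine Finset.sum_involution (fun p _ => ⟨p.2, p.1⟩) ?_ ?_ ?_ ?_
  · rintro ⟨j, i⟩ h
    simp only [Finset.mem_sigma, Finset.mem_erase] at h
    obtain ⟨hj, hij, hi⟩ := h
    dsimp only
    rw [mres_congr x (Finset.erase_right_comm : (J.erase j).erase i = (J.erase i).erase j) _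
      (((J.erase i).erase_subset j).trans (J.erase_subset i)), ← add_smul]
    have hz : ((-1 : ℤ) ^ (J.filter (· < j)).card * (-1) ^ ((J.erase j).filter (· < i)).card +
      (-1) ^ (J.filter (· < i)).card * (-1) ^ ((J.erase i).filter (· < j)).card) = 0 := by
      rcases lt_or_gt_of_ne hij with hlt | hlt
      · rw [card_filter_erase_of_le J hlt.le, ← card_filter_erase J hi hlt]
        ring
      · rw [card_filter_erase_of_le J hlt.le, ← card_filter_erase J hj hlt]
        ring
    rw [hz, zero_smul]
  · rintro ⟨j, i⟩ h _ heq
    simp only [Finset.mem_sigma, Finset.mem_erase] at h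
    simp only [Sigma.mk.injEq, heq_eq_eq] at heq
    exact h.2.1 heq.1
  · rintro ⟨j, i⟩ h
    simp only [Finset.mem_sigma, Finset.mem_erase] at h ⊢
    exact ⟨h.2.2, fun h' => h.2.1 h'.symm, h.1⟩
  · rintro ⟨j, i⟩ h
    rfl

/-- The cochains of cohomological degree `i`. -/
def Supp (i : ℤ) (c : MTotal x W) : Prop := ∀ J, (J.card : ℤ) ≠ i → c J = 0

variable {x}

theorem Supp.mdiff {i : ℤ} {c : MTotal x W} (h : Supp x i c) : Supp x (i + 1) (mdiff x c) := by
  intro J hJ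
  refine Finset.sum_eq_zero fun j hj => ?_
  rw [h, map_zero, smul_zero]
  have := Finset.card_erase_add_one hj
  omega

theorem Supp.add {i : ℤ} {c c' : MTotal x W} (h : Supp x i c) (h' : Supp x i c') :
    Supp x i (c + c') := fun J hJ => by rw [Pi.add_apply, h J hJ, h' J hJ, add_zero]

theorem Supp.sub {i : ℤ} {c c' : MTotal x W} (h : Supp x i c) (h' : Supp x i c') :
    Supp x i (c - c') := fun J hJ => by rw [Pi.sub_apply, h J hJ, h' J hJ, sub_zero]

theorem Supp.smul {i : ℤ} {c : MTotal x W} (h : Supp x i c) (r : S) :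
    Supp x i (r • c) := fun J hJ => by rw [Pi.smul_apply, h J hJ, smul_zero]

/-- A cocycle becomes a coboundary after multiplication by a power of `x j`. -/
theorem exists_pow_smul_eq_mdiff {i : ℤ} {c : MTotal x W} (hc : Supp x i c)
    (hd : mdiff x c = 0) (j : Fin s) :
    ∃ (k : ℕ) (b : MTotal x W), Supp x (i - 1) b ∧ x j ^ k • c = mdiff x b := by
  classical
  choose w k hwk using fun J => exists_frac (c J)
  -- a common denominator exponent
  obtain ⟨K, hK⟩ : ∃ K, ∀ J, k J ≤ K :=
    ⟨Finset.univ.sup k, fun J => Finset.le_sup (Finset.mem_univ J)⟩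
  -- The contracting homotopy of the direction `j`: `x_j ^ K c_{I ∪ {j}}`, with `x_j` cleared from
  -- its denominator so that it makes sense over `x_I`. It depends on the chosen numerators; the
  -- default value `0` when `c (insert j I) = 0` keeps `b` in a single cohomological degree.
  let b : MTotal x W := fun I => if j ∈ I ∨ c (insert j I) = 0 then 0 else
    (-1 : ℤ) ^ ((insert j I).filter (· < j)).card • frac _ (x j ^ (K - k (insert j I)) •
      w (insert j I)) (k (insert j I))
  have hb0 : ∀ I, j ∈ I → b I = 0 := fun I h => if_pos (Or.inl h)
  have hbJ : ∀ J, j ∈ J → mdiff x b J = x j ^ K • c J := by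
    intro J hj
    rw [mdiff_apply, Finset.sum_eq_single j]
    · have hins : insert j (J.erase j) = J := Finset.insert_erase hj
      by_cases hJ0 : c J = 0
      · rw [hJ0, smul_zero, show b (J.erase j) = 0 from if_pos (Or.inr (by rw [hins, hJ0])),
          map_zero, smul_zero]
      have h1 : b (J.erase j) = (-1 : ℤ) ^ (J.filter (· < j)).card •
          frac _ (x j ^ (K - k J) • w J) (k J) := by
        simp only [b, Finset.notMem_erase, false_or]
        rw [hins, if_neg hJ0]
      rw [h1, map_zsmul, smul_smul, ← mul_pow, neg_one_mul, neg_neg, one_pow, one_smul, mres_frac,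
        Finset.sdiff_erase_self hj, Finset.prod_singleton, smul_smul, ← pow_add,
        Nat.add_sub_cancel' (hK J), ← smul_frac, ← hwk]
    · intro i hi hij
      rw [hb0 _ (by simp [hj, hij.symm]), map_zero, smul_zero]
    · exact fun h => (h hj).elim
  have hbs : Supp x (i - 1) b := by
    intro I hI
    by_cases hj : j ∈ I
    · exact hb0 I hj
    · have h0 : c (insert j I) = 0 := by
        apply hc
        rw [Finset.card_insert_of_notMem hj]
        push_cast
        omega
      exact if_pos (Or.inr h0)
  -- The error is a cocycle that vanishes on all `J ∋ j`. For `j ∉ J` the cocycle condition at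
  -- `insert j J` has a single surviving term, the restriction of `c'_J`; thus `c'_J` dies after
  -- inverting `x_j` and is killed by a power of it.
  let c' := x j ^ K • c - mdiff x b
  have hc'd : mdiff x c' = 0 := by
    simp only [c', map_sub, mdiff_smul, hd, smul_zero, mdiff_mdiff, sub_zero]
  have hc'0 : ∀ J, j ∈ J → c' J = 0 := fun J hj => by
    simp only [c', Pi.sub_apply, Pi.smul_apply, hbJ J hj, sub_self]
  have hc' : ∀ J, ∃ l, x j ^ l • c' J = 0 := by
    intro J
    by_cases hj : j ∈ J
    · exact ⟨0, by rw [hc'0 J hj, smul_zero]⟩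
    have h1 := congrFun hc'd (insert j J)
    rw [mdiff_apply, Finset.sum_eq_single j] at h1
    · have h2 : mres x (Finset.subset_insert j J) (c' J) = 0 := by
        rw [mres_congr x (Finset.erase_insert hj).symm _ (Finset.erase_subset j _)]
        rcases Int.isUnit_iff.1 (IsUnit.pow ((insert j J).filter (· < j)).card
          (isUnit_one.neg : IsUnit (-1 : ℤ))) with h | h
        · rw [h, one_smul] at h1
          exact h1
        · rw [h, neg_one_smul] at h1
          exact neg_eq_zero.1 h1
      obtain ⟨v, l, hv⟩ := exists_frac (c' J)
      rw [hv, mres_frac, frac_eq_zero] at h2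
      obtain ⟨p, hp⟩ := h2
      rw [Finset.insert_sdiff_of_notMem _ hj, Finset.sdiff_self, Finset.prod_insert hj] at hp
      refine ⟨p + l, ?_⟩
      rw [hv, smul_frac, frac_eq_zero]
      refine ⟨p, ?_⟩
      rw [← hp]
      simp only [smul_smul, insert_empty_eq, Finset.prod_singleton]
      congr 1
      ring
    · intro i hi hij
      rw [hc'0 _ (by simp [hij.symm]), map_zero, smul_zero]
    · exact fun h => (h (Finset.mem_insert_self j J)).elim
  choose l hl using hc'
  obtain ⟨N, hN⟩ : ∃ N, ∀ J, l J ≤ N :=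
    ⟨Finset.univ.sup l, fun J => Finset.le_sup (Finset.mem_univ J)⟩
  refine ⟨N + K, x j ^ N • b, hbs.smul _, ?_⟩
  have h0 : x j ^ N • c' = 0 := by
    funext J
    rw [Pi.smul_apply, ← Nat.sub_add_cancel (hN J), pow_add, mul_smul, hl, smul_zero]
    rfl
  rw [mdiff_smul, pow_add, mul_smul, ← sub_eq_zero, ← smul_sub]
  exact h0

end Differential

/-! ### Functoriality and exactness -/

section Map

variable {W W' W'' : Type*} [AddCommGroup W'] [Module S W'] [AddCommGroup W''] [Module S W'']
  [AddCommGroup W] [Module S W]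

/-- The map induced by a linear map on a localization. -/
noncomputable def locMap (y : S) (f : W →ₗ[S] W') : Away y W →+ Away y W' :=
  lift (fun k => (fracHom y k).comp f.toAddMonoidHom) (by
    intro k w
    simp [frac_smul_succ])

theorem locMap_frac (y : S) (f : W →ₗ[S] W') (w : W) (k : ℕ) :
    locMap y f (frac y w k) = frac y (f w) k := lift_frac _ _ _ _

/-- The map induced by a linear map on Čech cochains. -/
noncomputable def mmap (f : W →ₗ[S] W') : MTotal x W →+ MTotal x W' where
  toFun c J := locMap _ f (c J)
  map_zero' := by funext J; simp
  map_add' c c' := by funext J; simp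

theorem mmap_apply (f : W →ₗ[S] W') (c : MTotal x W) (J : Finset (Fin s)) :
    mmap x f c J = locMap _ f (c J) := rfl

theorem mres_locMap (f : W →ₗ[S] W') {I J : Finset (Fin s)} (h : I ⊆ J) (z : MLoc x W I) :
    mres x h (locMap _ f z) = locMap _ f (mres x h z) := by
  obtain ⟨w, k, rfl⟩ := exists_frac z
  rw [locMap_frac, mres_frac, mres_frac, locMap_frac, map_smul]

theorem mdiff_mmap (f : W →ₗ[S] W') (c : MTotal x W) :
    mdiff x (mmap x f c) = mmap x f (mdiff x c) := by
  funext J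
  simp only [mdiff_apply, mmap_apply, mres_locMap, map_sum, map_zsmul]

variable {x}

theorem Supp.mmap {i : ℤ} {c : MTotal x W} (h : Supp x i c) (f : W →ₗ[S] W') :
    Supp x i (mmap x f c) := fun J hJ => by rw [mmap_apply, h J hJ, map_zero]

theorem mmap_injective {f : W →ₗ[S] W'} (hf : Function.Injective f) :
    Function.Injective (mmap x f) := by
  rw [injective_iff_map_eq_zero]
  intro c hc
  funext J
  have h := congrFun hc J
  rw [mmap_apply] at h
  obtain ⟨w, k, hw⟩ := exists_frac (c J)
  rw [hw, locMap_frac, Pi.zero_apply, frac_eq_zero] at h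
  obtain ⟨l, hl⟩ := h
  rw [hw, Pi.zero_apply, frac_eq_zero]
  exact ⟨l, hf (by rw [map_smul, hl, map_zero])⟩

theorem Supp.of_mmap {f : W →ₗ[S] W'} (hf : Function.Injective f) {i : ℤ} {c : MTotal x W}
    (h : Supp x i (Cech.mmap x f c)) : Supp x i c := by
  intro J hJ
  have h1 := h J hJ
  rw [mmap_apply] at h1
  obtain ⟨w, k, hw⟩ := exists_frac (c J)
  rw [hw, locMap_frac, frac_eq_zero] at h1
  obtain ⟨l, hl⟩ := h1
  rw [hw, frac_eq_zero]
  exact ⟨l, hf (by rw [map_smul, hl, map_zero])⟩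

theorem exists_mmap_eq {g : W →ₗ[S] W''} (hg : Function.Surjective g) {i : ℤ}
    {c : MTotal x W''} (hc : Supp x i c) : ∃ b, Supp x i b ∧ mmap x g b = c := by
  classical
  choose w k hw using fun J => exists_frac (c J)
  choose v hv using fun J => hg (w J)
  refine ⟨fun J => if (J.card : ℤ) = i then frac _ (v J) (k J) else 0, fun J hJ => if_neg hJ, ?_⟩
  funext J
  rw [mmap_apply]
  split_ifs with h
  · rw [locMap_frac, hv, ← hw]
  · rw [map_zero, hc J h]

theorem exists_mmap_eq_of_exact {f : W' →ₗ[S] W} {g : W →ₗ[S] W''} (hf : Function.Injective f)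
    (hfg : Function.Exact f g) {i : ℤ} {c : MTotal x W} (hc : Supp x i c)
    (h0 : mmap x g c = 0) : ∃ b, Supp x i b ∧ mmap x f b = c := by
  have key : ∀ J, ∃ b : MLoc x W' J, locMap _ f b = c J := by
    intro J
    have h := congrFun h0 J
    rw [mmap_apply] at h
    obtain ⟨w, k, hw⟩ := exists_frac (c J)
    rw [hw, locMap_frac, Pi.zero_apply, frac_eq_zero] at h
    obtain ⟨l, hl⟩ := h
    rw [← map_smul, hfg] at hl
    obtain ⟨v, hv⟩ := hl
    refine ⟨frac _ v (k + l), ?_⟩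
    rw [locMap_frac, hv, frac_pow_smul, hw]
  choose b hb using key
  have hb' : mmap x f b = c := funext hb
  exact ⟨b, Supp.of_mmap hf (hb' ▸ hc), hb'⟩

theorem mmap_mmap_of_exact {f : W' →ₗ[S] W} {g : W →ₗ[S] W''}
    (hfg : Function.Exact f g) (c : MTotal x W') : mmap x g (mmap x f c) = 0 := by
  funext J
  rw [mmap_apply, mmap_apply]
  obtain ⟨w, k, hw⟩ := exists_frac (c J)
  rw [hw, locMap_frac, locMap_frac, hfg.apply_apply_eq_zero, frac_zero]
  rfl

end Map

/-! ### Gradings, given by their projections -/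

/-- Projections onto the homogeneous components of an `S`-module, compatible with the
multiplications by the elements `x j` of degree `e j`. -/
structure Proj (e : Fin s → ℕ) (W : Type*) [AddCommGroup W] [Module S W] where
  /-- the projection onto the component of degree `n` -/
  π : ℤ → W →+ W
  idem : ∀ n w, π n (π n w) = π n w
  smul : ∀ n j w, π (n + e j) (x j • w) = x j • π n w

namespace Proj

variable {x} {e : Fin s → ℕ} {W W' W'' : Type*} [AddCommGroup W] [Module S W]
  [AddCommGroup W'] [Module S W'] [AddCommGroup W''] [Module S W'']

theorem prod_smul (P : Proj x e W) (J : Finset (Fin s)) (n : ℤ) (w : W) :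
    P.π (n + (∑ j ∈ J, e j : ℕ)) ((∏ j ∈ J, x j) • w) = (∏ j ∈ J, x j) • P.π n w := by
  classical
  induction J using Finset.induction_on generalizing n w with
  | empty => simp
  | insert j J hj ih =>
    rw [Finset.prod_insert hj, Finset.sum_insert hj, mul_smul, mul_smul, ← ih, ← P.smul]
    congr 2
    push_cast
    ring

theorem pow_smul (P : Proj x e W) (J : Finset (Fin s)) (k : ℕ) (n : ℤ) (w : W) :
    P.π (n + k * (∑ j ∈ J, e j : ℕ)) ((∏ j ∈ J, x j) ^ k • w) =
      (∏ j ∈ J, x j) ^ k • P.π n w := by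
  induction k generalizing n w with
  | zero => simp
  | succ k ih =>
    rw [pow_succ, mul_smul, mul_smul, ← P.prod_smul, ← ih]
    congr 2
    push_cast
    ring

/-- The projection onto the component of degree `n` of a localization. -/
noncomputable def loc (P : Proj x e W) (J : Finset (Fin s)) (n : ℤ) : MLoc x W J →+ MLoc x W J :=
  lift (fun k => (fracHom _ k).comp (P.π (n + k * (∑ j ∈ J, e j : ℕ)))) (by
    intro k w
    simp only [AddMonoidHom.comp_apply, fracHom_apply]
    rw [← frac_smul_succ (P.π _ w), ← P.prod_smul]
    congr 3
    push_cast
    ring)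

theorem loc_frac (P : Proj x e W) (J : Finset (Fin s)) (n : ℤ) (w : W) (k : ℕ) :
    P.loc J n (frac _ w k) = frac _ (P.π (n + k * (∑ j ∈ J, e j : ℕ)) w) k :=
  lift_frac _ _ _ _

/-- The projection onto the cochains of degree `n`. -/
noncomputable def tot (P : Proj x e W) (n : ℤ) : MTotal x W →+ MTotal x W where
  toFun c J := P.loc J n (c J)
  map_zero' := by funext J; simp
  map_add' c c' := by funext J; simp

theorem tot_apply (P : Proj x e W) (n : ℤ) (c : MTotal x W) (J : Finset (Fin s)) :
    P.tot n c J = P.loc J n (c J) := rfl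

theorem tot_tot (P : Proj x e W) (n : ℤ) (c : MTotal x W) : P.tot n (P.tot n c) = P.tot n c := by
  funext J
  rw [tot_apply, tot_apply]
  obtain ⟨w, k, hw⟩ := exists_frac (c J)
  rw [hw, loc_frac, loc_frac, P.idem]

theorem mres_loc (P : Proj x e W) {I J : Finset (Fin s)} (h : I ⊆ J) (n : ℤ) (z : MLoc x W I) :
    mres x h (P.loc I n z) = P.loc J n (mres x h z) := by
  obtain ⟨w, k, rfl⟩ := exists_frac z
  rw [loc_frac, mres_frac, mres_frac, loc_frac, ← P.pow_smul]
  congr 2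
  rw [← Finset.sum_sdiff h]
  push_cast
  ring_nf

theorem mdiff_tot (P : Proj x e W) (n : ℤ) (c : MTotal x W) :
    mdiff x (P.tot n c) = P.tot n (mdiff x c) := by
  funext J
  simp only [mdiff_apply, tot_apply, mres_loc, map_sum, map_zsmul]

theorem tot_pow_smul (P : Proj x e W) (n : ℤ) (c : MTotal x W) (j : Fin s) (k : ℕ) :
    P.tot (n + k * e j) (x j ^ k • c) = x j ^ k • P.tot n c := by
  funext J
  rw [tot_apply, Pi.smul_apply, Pi.smul_apply, tot_apply]
  obtain ⟨w, l, hw⟩ := exists_frac (c J)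
  rw [hw, smul_frac, loc_frac, loc_frac, smul_frac]
  have := P.pow_smul {j} k (n + l * (∑ j ∈ J, e j : ℕ)) w
  simp only [Finset.prod_singleton, Finset.sum_singleton] at this
  rw [← this]
  congr 2
  ring_nf

theorem supp_tot (P : Proj x e W) (n : ℤ) {i : ℤ} {c : MTotal x W} (h : Supp x i c) :
    Supp x i (P.tot n c) := fun J hJ => by rw [tot_apply, h J hJ, map_zero]

theorem mmap_tot (P : Proj x e W) (P' : Proj x e W') (f : W →ₗ[S] W') (t : ℤ)
    (hf : ∀ n w, f (P.π n w) = P'.π (n + t) (f w)) (n : ℤ) (c : MTotal x W) :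
    mmap x f (P.tot n c) = P'.tot (n + t) (mmap x f c) := by
  funext J
  rw [mmap_apply, tot_apply, tot_apply, mmap_apply]
  obtain ⟨w, k, hw⟩ := exists_frac (c J)
  rw [hw, loc_frac, locMap_frac, locMap_frac, loc_frac, hf]
  congr 2
  ring_nf

/-- The component of degree `n` of the `i`-th Čech cohomology of a graded module is zero. -/
def Vanish (P : Proj x e W) (i n : ℤ) : Prop :=
  ∀ c : MTotal x W, Supp x i c → P.tot n c = c → mdiff x c = 0 →
    ∃ b : MTotal x W, Supp x (i - 1) b ∧ mdiff x b = c

/-- A coboundary of degree `n` is the coboundary of a cochain of degree `n`. -/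
theorem exists_tot_eq (P : Proj x e W) {i n : ℤ} {b c : MTotal x W} (hb : Supp x i b)
    (hc : P.tot n c = c) (h : mdiff x b = c) :
    ∃ b', Supp x i b' ∧ P.tot n b' = b' ∧ mdiff x b' = c :=
  ⟨P.tot n b, P.supp_tot n hb, P.tot_tot n b, by rw [mdiff_tot, h, hc]⟩

variable {P' : Proj x e W'} {P : Proj x e W} {P'' : Proj x e W''}
  {f : W' →ₗ[S] W} {g : W →ₗ[S] W''} {t : ℤ}

/-- Exactness of `H^i(W') → H^i(W) → H^i(W'')` at the middle, where `f` raises degrees by `t`. The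
lift `β` of a primitive of `g c` is projected to degree `n + t` first, so that the correction `c'`
on `W'` is homogeneous of degree `n`. -/
theorem Vanish.of_exact (hf : Function.Injective f) (hg : Function.Surjective g)
    (hfg : Function.Exact f g) (hP' : ∀ n w, f (P'.π n w) = P.π (n + t) (f w))
    (hP : ∀ n w, g (P.π n w) = P''.π n (g w)) {i n : ℤ} (h' : P'.Vanish i n)
    (h'' : P''.Vanish i (n + t)) : P.Vanish i (n + t) := by
  have hP0 : ∀ n w, g (P.π n w) = P''.π (n + 0) (g w) := by simpa using hP
  intro c hc hcn hcd
  obtain ⟨b'', hb'', hb''d⟩ := h'' (mmap x g c) (hc.mmap g)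
    (by conv_rhs => rw [← hcn, mmap_tot P P'' g 0 hP0, add_zero])
    (by rw [mdiff_mmap, hcd, map_zero])
  obtain ⟨β, hβ, rfl⟩ := exists_mmap_eq hg hb''
  have hd : mdiff x (mmap x g (P.tot (n + t) β)) = mmap x g c := by
    rw [mmap_tot P P'' g 0 hP0, mdiff_tot, hb''d, add_zero]
    conv_rhs => rw [← hcn, mmap_tot P P'' g 0 hP0, add_zero]
  obtain ⟨c', hc', hfc'⟩ := exists_mmap_eq_of_exact hf hfg (i := i)
    (c := c - mdiff x (P.tot (n + t) β))
    (hc.sub (by simpa using (P.supp_tot (n + t) hβ).mdiff))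
    (by rw [map_sub, ← mdiff_mmap, hd, sub_self])
  obtain ⟨b', hb', hb'd⟩ := h' c' hc'
    (mmap_injective hf (by
      rw [mmap_tot P' P f t hP', hfc', map_sub, hcn, mdiff_tot, P.tot_tot]))
    (mmap_injective hf (by
      rw [← mdiff_mmap, hfc', map_sub, hcd, mdiff_mdiff, map_zero, sub_zero]))
  refine ⟨P.tot (n + t) β + mmap x f b', (P.supp_tot _ hβ).add (hb'.mmap f), ?_⟩
  rw [map_add, mdiff_mmap, hb'd, hfc', add_sub_cancel]

/-- Injectivity of `H^i(W')_n → H^i(W)_{n+t}` when `H^{i-1}(W'')_{n+t} = 0`: a primitive `b` of `f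
c` becomes a cocycle on `W''`, hence a coboundary, and subtracting a lifted coboundary moves `b`
into `W'`. -/
theorem exists_mdiff_eq_of_mmap (hf : Function.Injective f) (hg : Function.Surjective g)
    (hfg : Function.Exact f g) (hP' : ∀ n w, f (P'.π n w) = P.π (n + t) (f w))
    (hP : ∀ n w, g (P.π n w) = P''.π n (g w)) {i n : ℤ} (h'' : P''.Vanish (i - 1) (n + t))
    {c : MTotal x W'} (hc : P'.tot n c = c)
    {b : MTotal x W} (hb : Supp x (i - 1) b) (hbd : mdiff x b = mmap x f c) :
    ∃ b', Supp x (i - 1) b' ∧ mdiff x b' = c := by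
  have hP0 : ∀ n w, g (P.π n w) = P''.π (n + 0) (g w) := by simpa using hP
  obtain ⟨b, hb, hbn, hbd⟩ := P.exists_tot_eq (n := n + t) hb
    (by rw [← mmap_tot P' P f t hP', hc]) hbd
  obtain ⟨b'', hb'', hb''d⟩ := h'' (mmap x g b) (hb.mmap g)
    (by conv_rhs => rw [← hbn, mmap_tot P P'' g 0 hP0, add_zero])
    (by rw [mdiff_mmap, hbd, mmap_mmap_of_exact hfg])
  obtain ⟨β, hβ, rfl⟩ := exists_mmap_eq hg hb''
  obtain ⟨b', hb', hfb'⟩ := exists_mmap_eq_of_exact hf hfg (i := i - 1) (c := b - mdiff x β)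
    (hb.sub (by simpa using hβ.mdiff)) (by rw [map_sub, ← mdiff_mmap, hb''d, sub_self])
  refine ⟨b', hb', mmap_injective hf ?_⟩
  rw [← mdiff_mmap, hfb', map_sub, hbd, mdiff_mdiff, sub_zero]

/-- The connecting map `H^i(W'')_{n+t} → H^{i+1}(W')_n` is injective if `H^i(W)_{n+t} = 0`; this is
the snake construction, carried out with homogeneous lifts. -/
theorem not_vanish_of_connecting (hf : Function.Injective f) (hg : Function.Surjective g)
    (hfg : Function.Exact f g) (hP' : ∀ n w, f (P'.π n w) = P.π (n + t) (f w))
    (hP : ∀ n w, g (P.π n w) = P''.π n (g w)) {i n : ℤ} (h : P.Vanish i (n + t))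
    (h'' : ¬ P''.Vanish i (n + t)) : ¬ P'.Vanish (i + 1) n := by
  have hP0 : ∀ n w, g (P.π n w) = P''.π (n + 0) (g w) := by simpa using hP
  intro h'
  refine h'' fun c'' hc'' hc''n hc''d => ?_
  obtain ⟨c₀, hc₀, hgc₀⟩ := exists_mmap_eq hg hc''
  have hgc : mmap x g (P.tot (n + t) c₀) = c'' := by
    rw [mmap_tot P P'' g 0 hP0, hgc₀, add_zero, hc''n]
  have hc := P.supp_tot (n + t) hc₀
  have hcn := P.tot_tot (n + t) c₀
  generalize P.tot (n + t) c₀ = c at *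
  obtain ⟨c', hc', hfc'⟩ := exists_mmap_eq_of_exact hf hfg hc.mdiff
    (by rw [← mdiff_mmap, hgc, hc''d])
  have hc'n : P'.tot n c' = c' := mmap_injective hf (by
    rw [mmap_tot P' P f t hP', hfc', ← mdiff_tot, hcn])
  obtain ⟨b₀, hb₀, hb₀d⟩ := h' c' hc' hc'n
    (mmap_injective hf (by rw [← mdiff_mmap, hfc', mdiff_mdiff, map_zero]))
  rw [add_sub_cancel_right] at hb₀
  obtain ⟨b, hb, hbn, hbd⟩ := P'.exists_tot_eq hb₀ hc'n hb₀d
  obtain ⟨β, hβ, hβd⟩ := h (c - mmap x f b) (hc.sub (hb.mmap f))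
    (by rw [map_sub, hcn, ← mmap_tot P' P f t hP', hbn])
    (by rw [map_sub, mdiff_mmap, hbd, hfc', sub_self])
  refine ⟨mmap x g β, hβ.mmap g, ?_⟩
  rw [mdiff_mmap, hβd, map_sub, mmap_mmap_of_exact hfg, sub_zero, hgc]

/-- With `H^{i+1}(W')_n = 0` the map `H^i(W) → H^i(W'')` is onto in degree `n + t`, so a nonzero
class downstairs forces one upstairs. -/
theorem not_vanish_of_surjective (hf : Function.Injective f) (hg : Function.Surjective g)
    (hfg : Function.Exact f g) (hP' : ∀ n w, f (P'.π n w) = P.π (n + t) (f w))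
    (hP : ∀ n w, g (P.π n w) = P''.π n (g w)) {i n : ℤ}
    (hvan : P'.Vanish (i + 1) n) (hne : ¬ P''.Vanish i (n + t)) : ¬ P.Vanish i (n + t) :=
  fun h => not_vanish_of_connecting hf hg hfg hP' hP h hne hvan

/-- If `x j` is regular on `W`, the cohomology of `W` vanishes in the degrees in which that of
`W / x j W` does, one cohomological degree below. -/
theorem Vanish.of_regular {j : Fin s} (hreg : ∀ w : W, x j • w = 0 → w = 0)
    (hg : Function.Surjective g) (hker : ∀ w, g w = 0 → ∃ v, w = x j • v)
    (hg0 : ∀ w, g (x j • w) = 0)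
    (hP : ∀ n w, g (P.π n w) = P''.π n (g w)) {i n : ℤ}
    (h'' : ∀ k : ℕ, P''.Vanish (i - 1) (n + (k + 1) * e j)) : P.Vanish i n := by
  let f : W →ₗ[S] W := LinearMap.lsmul S W (x j)
  have hfa : ∀ w, f w = x j • w := fun w => rfl
  have hf : Function.Injective f := (injective_iff_map_eq_zero f).2 hreg
  have hfg : Function.Exact f g := by
    intro w
    constructor
    · intro h
      obtain ⟨v, rfl⟩ := hker w h
      exact ⟨v, rfl⟩
    · rintro ⟨v, rfl⟩
      exact hg0 v
  have hfm : ∀ c : MTotal x W, mmap x f c = x j • c := by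
    intro c
    funext J
    rw [mmap_apply, Pi.smul_apply]
    obtain ⟨w, k, hw⟩ := exists_frac (c J)
    rw [hw, locMap_frac, smul_frac, hfa]
  intro c hc hcn hcd
  -- Every class is killed by a power of `x_j`, while the hypothesis on `W''` makes multiplication
  -- by `x_j` injective on `H^i` in the degrees `n + k e_j`. The factors are cancelled one at a
  -- time.
  obtain ⟨k, b, hb, hbd⟩ := exists_pow_smul_eq_mdiff hc hcd j
  induction k generalizing b with
  | zero => exact ⟨b, hb, by rw [← hbd, pow_zero, one_smul]⟩
  | succ k ih =>
    have hk := h'' k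
    rw [add_mul, one_mul, ← add_assoc] at hk
    obtain ⟨b', hb', hb'd⟩ := exists_mdiff_eq_of_mmap (P' := P) (t := e j) hf hg hfg
      (fun n w => (P.smul n j w).symm) hP hk (c := x j ^ k • c)
      (by rw [tot_pow_smul, hcn]) hb (by rw [hfm, ← hbd, smul_smul, ← pow_succ'])
    exact ih b' hb' hb'd.symm

end Proj

end Cech

namespace Cech

open AwayModule

/-! ### Vanishing above the dimension -/

section Vanishing

variable {S : Type*} [CommRing S] {s : ℕ} (x : Fin s → S)

/-- The trivial grading: all elements are homogeneous of every degree. -/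
def Proj.trivial (W : Type*) [AddCommGroup W] [Module S W] : Proj x 0 W where
  π _ := AddMonoidHom.id W
  idem _ _ := rfl
  smul _ _ _ := rfl

variable {x} {e : Fin s → ℕ} {W : Type*} [AddCommGroup W] [Module S W]

theorem Proj.tot_trivial (n : ℤ) (c : MTotal x W) : (Proj.trivial x W).tot n c = c := by
  funext J
  rw [tot_apply]
  obtain ⟨w, k, hw⟩ := exists_frac (c J)
  rw [hw, loc_frac]
  rfl

/-- For the trivial grading the condition on degrees is empty, so its vanishing is that of the whole
cohomology and passes to any grading. -/
theorem Proj.Vanish.of_trivial {i m : ℤ} (h : (Proj.trivial x W).Vanish i m) (P : Proj x e W)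
    (n : ℤ) : P.Vanish i n :=
  fun c hc _ hd => h c hc (Proj.tot_trivial _ _) hd

theorem Proj.Vanish.of_forall_eq_zero {P : Proj x e W} {i n : ℤ}
    (h : ∀ J : Finset (Fin s), (J.card : ℤ) = i → ∀ z : MLoc x W J, z = 0) : P.Vanish i n := by
  intro c hc _ _
  have : c = 0 := by
    funext J
    by_cases hJ : (J.card : ℤ) = i
    · exact h J hJ _
    · exact hc J hJ
  exact ⟨0, fun _ _ => rfl, by rw [this, map_zero]⟩

theorem Proj.Vanish.of_subsingleton [Subsingleton W] {P : Proj x e W} {i n : ℤ} :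
    P.Vanish i n :=
  .of_forall_eq_zero fun J _ z => by
    obtain ⟨w, k, rfl⟩ := exists_frac z
    rw [Subsingleton.elim w 0, frac_zero]

theorem MLoc.eq_zero_of_smul_eq_zero (h : ∀ j (w : W), x j • w = 0) {J : Finset (Fin s)}
    (hJ : J.Nonempty) (z : MLoc x W J) : z = 0 := by
  obtain ⟨w, k, rfl⟩ := exists_frac z
  obtain ⟨j, hj⟩ := hJ
  refine frac_eq_zero.2 ⟨1, ?_⟩
  rw [pow_one, ← Finset.prod_erase_mul _ _ hj, mul_smul, h, smul_zero]

theorem Proj.Vanish.of_smul_eq_zero {P : Proj x e W} (h : ∀ j (w : W), x j • w = 0) {i n : ℤ}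
    (hi : i ≠ 0) : P.Vanish i n :=
  .of_forall_eq_zero fun J hJ z => MLoc.eq_zero_of_smul_eq_zero h
    (Finset.card_pos.1 (by omega)) z

/-- The cohomology of a finite module over a Noetherian ring vanishes above its dimension. -/
theorem vanish_of_supportDim_lt {S : Type*} [CommRing S] [IsNoetherianRing S] {s : ℕ}
    (x : Fin s → S) (i : ℕ) (n : ℤ) (W : Type*) [AddCommGroup W] [Module S W]
    [hW : Module.Finite S W] (h : Module.supportDim S W < i) :
    (Proj.trivial x W).Vanish i n := by
  induction i generalizing W with
  | zero =>
    have : Subsingleton W := by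
      rw [← Module.supportDim_eq_bot_iff_subsingleton S]
      by_contra hb
      rw [← WithBot.coe_unbot _ hb] at h
      exact absurd (WithBot.coe_lt_coe.1 h) (by simp)
    exact .of_subsingleton
  | succ i ih =>
    -- Prime filtration: the extension step is the exactness lemma, leaving `W ≅ S / p`.
    induction hW using IsNoetherianRing.induction_on_isQuotientEquivQuotientPrime S with
    | subsingleton N => exact .of_subsingleton
    | quotient N p φ =>
      -- If all `x j` lie in `p`, they act as zero and the localizations at nonempty `J` are zero.
      -- Otherwise some `x j` is regular on `S / p`; dividing by it lowers the dimension, and the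
      -- cohomology one degree below vanishes by induction.
      by_cases hx : ∀ j, x j ∈ p.1
      · refine .of_smul_eq_zero (fun j w => φ.injective ?_) (by omega)
        rw [map_smul, map_zero]
        obtain ⟨r, hr⟩ := Ideal.Quotient.mk_surjective (φ w)
        rw [← hr, Algebra.smul_def, Ideal.Quotient.algebraMap_eq, ← map_mul,
          Ideal.Quotient.eq_zero_iff_mem]
        exact p.1.mul_mem_right _ (hx j)
      · push Not at hx
        obtain ⟨j, hj⟩ := hx
        have hreg : ∀ w : N, x j • w = 0 → w = 0 := by
          intro w hw
          apply φ.injective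
          have h1 := congrArg φ hw
          rw [map_smul, map_zero] at h1
          obtain ⟨r, hr⟩ := Ideal.Quotient.mk_surjective (φ w)
          rw [← hr, Algebra.smul_def, Ideal.Quotient.algebraMap_eq, ← map_mul,
            Ideal.Quotient.eq_zero_iff_mem] at h1
          rw [map_zero, ← hr, Ideal.Quotient.eq_zero_iff_mem]
          exact (p.2.mem_or_mem h1).resolve_left hj
        have hreg' : IsSMulRegular N (x j) := fun a b hab => by
          rw [← sub_eq_zero]
          exact hreg _ (by rw [smul_sub]; exact sub_eq_zero.2 hab)
        have hdim : Module.supportDim S (QuotSMulTop (x j) N) < i := by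
          have h1 := (Module.supportDim_quotSMulTop_succ_le_of_notMem_minimalPrimes
            (fun q hq => hreg'.notMem_of_mem_minimalPrimes hq)).trans_lt h
          rw [Nat.cast_succ] at h1
          exact lt_of_add_lt_add_right h1
        refine Proj.Vanish.of_regular (j := j) (P'' := Proj.trivial x (QuotSMulTop (x j) N))
          (g := Submodule.mkQ _) hreg (Submodule.mkQ_surjective _) ?_ ?_ (fun _ _ => rfl) ?_
        · intro w hw
          rw [Submodule.mkQ_apply, Submodule.Quotient.mk_eq_zero,
            Submodule.mem_smul_pointwise_iff_exists] at hw
          obtain ⟨v, -, rfl⟩ := hw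
          exact ⟨v, rfl⟩
        · intro w
          rw [Submodule.mkQ_apply, Submodule.Quotient.mk_eq_zero,
            Submodule.mem_smul_pointwise_iff_exists]
          exact ⟨w, Submodule.mem_top, rfl⟩
        · intro k
          push_cast
          rw [add_sub_cancel_right]
          intro c hc hcn hcd
          exact ih _ hdim c hc (Proj.tot_trivial _ _) hcd
    | exact N₁ N₂ N₃ f g hf hg hfg h₁ h₃ =>
      have := Proj.Vanish.of_exact (P := Proj.trivial x N₂) (t := 0) (n := n) hf hg hfg
        (fun _ _ => rfl) (fun _ _ => rfl)
        (h₁ ((Module.supportDim_le_of_injective f hf).trans_lt h)) (by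
          rw [add_zero]; exact h₃ ((Module.supportDim_le_of_surjective g hg).trans_lt h))
      rwa [add_zero] at this

end Vanishing
end Cech

/-! ### Homogeneous components of polynomials, in integer degrees -/

namespace MvPolynomial

variable {σ k : Type*} [CommRing k]

/-- The homogeneous component of degree `n : ℤ`, which is zero for negative `n`. -/
noncomputable def degreeProj (n : ℤ) : MvPolynomial σ k →+ MvPolynomial σ k :=
  if 0 ≤ n then (homogeneousComponent n.toNat).toAddMonoidHom else 0

theorem coeff_degreeProj (n : ℤ) (p : MvPolynomial σ k) (m : σ →₀ ℕ) :
    coeff m (degreeProj n p) = if (m.degree : ℤ) = n then coeff m p else 0 := by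
  unfold degreeProj
  split_ifs with h1 h2 h2
  · exact (coeff_homogeneousComponent _ _ _).trans (if_pos (by omega))
  · exact (coeff_homogeneousComponent _ _ _).trans (if_neg (by omega))
  · omega
  · simp

theorem degreeProj_mul {e : ℕ} {q : MvPolynomial σ k} (hq : q.IsHomogeneous e) (n : ℤ)
    (p : MvPolynomial σ k) : degreeProj (n + e) (q * p) = q * degreeProj n p := by
  classical
  ext m
  rw [coeff_degreeProj, coeff_mul, coeff_mul]
  trans ∑ a ∈ Finset.HasAntidiagonal.antidiagonal m,
    if (m.degree : ℤ) = n + e then coeff a.1 q * coeff a.2 p else 0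
  · split_ifs <;> simp
  refine Finset.sum_congr rfl ?_
  rintro ⟨a, b⟩ hab
  rw [Finset.HasAntidiagonal.mem_antidiagonal] at hab
  dsimp only at hab ⊢
  rw [coeff_degreeProj]
  by_cases ha : coeff a q = 0
  · simp [ha]
  · have hdeg : a.degree = e := by
      rw [Finsupp.degree_eq_weight_one]
      exact hq ha
    have hm : m.degree = a.degree + b.degree := by rw [← hab, map_add]
    have : (m.degree : ℤ) = n + e ↔ (b.degree : ℤ) = n := by omega
    simp only [this, mul_ite, mul_zero]

theorem degreeProj_idem (n : ℤ) (p : MvPolynomial σ k) :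
    degreeProj n (degreeProj n p) = degreeProj n p := by
  ext m
  simp only [coeff_degreeProj]
  split_ifs <;> rfl

/-- The substitution of `0` for the first variable. -/
noncomputable def killFirst (k : Type*) [CommRing k] (d : ℕ) :
    MvPolynomial (Fin (d + 1)) k →+* MvPolynomial (Fin d) k :=
  (Polynomial.constantCoeff).comp (finSuccEquiv k d).toRingEquiv.toRingHom

theorem killFirst_apply {d : ℕ} (p : MvPolynomial (Fin (d + 1)) k) :
    killFirst k d p = (finSuccEquiv k d p).coeff 0 := rfl

theorem coeff_killFirst {d : ℕ} (p : MvPolynomial (Fin (d + 1)) k) (m : Fin d →₀ ℕ) :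
    coeff m (killFirst k d p) = coeff (Finsupp.cons 0 m) p :=
  finSuccEquiv_coeff_coeff m p 0

theorem killFirst_X_succ {d : ℕ} (i : Fin d) : killFirst k d (X i.succ) = X i := by
  rw [killFirst_apply, finSuccEquiv_X_succ, Polynomial.coeff_C_zero]

theorem killFirst_X_zero {d : ℕ} : killFirst k d (X 0) = 0 := by
  rw [killFirst_apply, finSuccEquiv_X_zero, Polynomial.coeff_X_zero]

theorem killFirst_surjective {d : ℕ} : Function.Surjective (killFirst k d) := by
  intro p
  refine ⟨(finSuccEquiv k d).symm (Polynomial.C p), ?_⟩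
  rw [killFirst_apply, AlgEquiv.apply_symm_apply, Polynomial.coeff_C_zero]

theorem X_zero_dvd_of_killFirst_eq_zero {d : ℕ} {p : MvPolynomial (Fin (d + 1)) k}
    (h : killFirst k d p = 0) : X 0 ∣ p := by
  rw [killFirst_apply, ← Polynomial.X_dvd_iff] at h
  rw [← map_dvd_iff (finSuccEquiv k d), finSuccEquiv_X_zero]
  exact h

theorem degree_cons_zero {d : ℕ} (m : Fin d →₀ ℕ) : (Finsupp.cons 0 m).degree = m.degree := by
  simp [Finsupp.degree_eq_sum, Fin.sum_univ_succ]

theorem killFirst_degreeProj {d : ℕ} (n : ℤ) (p : MvPolynomial (Fin (d + 1)) k) :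
    killFirst k d (degreeProj n p) = degreeProj n (killFirst k d p) := by
  ext m
  rw [coeff_killFirst, coeff_degreeProj, coeff_degreeProj, coeff_killFirst, degree_cons_zero]

theorem IsHomogeneous.killFirst {d e : ℕ} {p : MvPolynomial (Fin (d + 1)) k}
    (h : p.IsHomogeneous e) : (killFirst k d p).IsHomogeneous e :=
  h.finSuccEquiv_coeff_isHomogeneous 0 e (zero_add e)

theorem constantCoeff_killFirst {d : ℕ} (p : MvPolynomial (Fin (d + 1)) k) :
    constantCoeff (killFirst k d p) = constantCoeff p := by
  rw [constantCoeff_eq, coeff_killFirst, constantCoeff_eq]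
  congr 1
  exact Finsupp.cons_zero_zero

end MvPolynomial

/-! ### The cohomology of a polynomial ring -/

namespace Cech

open AwayModule MvPolynomial

variable {S : Type*} [CommRing S] {s : ℕ} {x : Fin s → S} {e : Fin s → ℕ}
  {k : Type*} [Field k]

/-- The grading of a polynomial ring, seen as a module over a ring mapping to it. -/
noncomputable def polyProj {σ : Type*} [Module S (MvPolynomial σ k)] (ψ : S →+* MvPolynomial σ k)
    (hψ : ∀ r p, r • p = ψ r * p) (hx : ∀ j, (ψ (x j)).IsHomogeneous (e j)) :
    Proj x e (MvPolynomial σ k) where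
  π := degreeProj
  idem := degreeProj_idem
  smul n j p := by rw [hψ, hψ, degreeProj_mul (hx j)]

/-- The cohomology of a polynomial ring in `d` variables is concentrated in cohomological
degree `d`, where its top degree is `-d`. -/
theorem polyProj_cohomology (d : ℕ) [hmod : Module S (MvPolynomial (Fin d) k)]
    (ψ : S →+* MvPolynomial (Fin d) k)
    (hψ : ∀ r p, r • p = ψ r * p) (hx : ∀ j, (ψ (x j)).IsHomogeneous (e j))
    (hc : ∀ j, constantCoeff (ψ (x j)) = 0) (hX : ∀ i, ∃ j, ψ (x j) = X i ∧ e j = 1) :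
    (∀ i n : ℤ, i ≠ d → (polyProj ψ hψ hx).Vanish i n) ∧
    (∀ n : ℤ, -(d : ℤ) < n → (polyProj ψ hψ hx).Vanish d n) ∧
    ¬ (polyProj ψ hψ hx).Vanish d (-(d : ℤ)) := by
  induction d generalizing hmod with
  | zero =>
    -- Without variables, `ψ (x j)` is a constant with zero constant term, hence zero. Only the term
    -- `J = ∅` of the complex survives: it is `k`, placed in degree `0`.
    have h0 : ∀ j (w : MvPolynomial (Fin 0) k), x j • w = 0 := by
      intro j w
      rw [hψ, eq_C_of_isEmpty (ψ (x j)), ← constantCoeff_eq, hc, C_0, zero_mul]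
    have hne : ∀ (c : MTotal x (MvPolynomial (Fin 0) k)) J, J ≠ ∅ → c J = 0 := fun c J hJ =>
      MLoc.eq_zero_of_smul_eq_zero h0 (Finset.nonempty_iff_ne_empty.2 hJ) _
    refine ⟨fun i n hi => .of_smul_eq_zero h0 (by simpa using hi), ?_, ?_⟩
    · intro n hn c hcs hcn hcd
      have : c = 0 := by
        funext J
        by_cases hJ : J = ∅
        · subst hJ
          obtain ⟨w, l, hw⟩ := exists_frac (c ∅)
          rw [← hcn, Proj.tot_apply, hw, Proj.loc_frac]
          have : (polyProj ψ hψ hx).π (n + l * (∑ j ∈ (∅ : Finset (Fin s)), e j : ℕ)) w = 0 := by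
            ext m
            refine (coeff_degreeProj _ _ _).trans (if_neg ?_)
            rw [Subsingleton.elim m 0]
            simp only [Nat.cast_zero, neg_zero] at hn
            simpa using hn.ne
          rw [this, frac_zero]
          rfl
        · exact hne c J hJ
      exact ⟨0, fun _ _ => rfl, by rw [this, map_zero]⟩
    · intro h
      let c : MTotal x (MvPolynomial (Fin 0) k) := fun J => if J = ∅ then frac _ 1 0 else 0
      have hc0 : c ∅ = frac _ 1 0 := if_pos rfl
      suffices hb : ∃ b : MTotal x (MvPolynomial (Fin 0) k),
          Supp x (((0 : ℕ) : ℤ) - 1) b ∧ mdiff x b = c by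
        obtain ⟨b, hb, hbd⟩ := hb
        -- There are no cochains of cohomological degree `-1`, so `1 ∈ k` is not a coboundary.
        have hb0 : b = 0 := funext fun J => hb J (by
          simp only [Nat.cast_zero]
          omega)
        have h1 := congrFun hbd ∅
        rw [hb0, map_zero, hc0, eq_comm, Pi.zero_apply, frac_eq_zero] at h1
        obtain ⟨l, hl⟩ := h1
        simp at hl
      refine h c ?_ ?_ ?_
      · intro J hJ
        apply hne
        rintro rfl
        simp at hJ
      · funext J
        by_cases hJ : J = ∅
        · subst hJ
          rw [Proj.tot_apply, hc0, Proj.loc_frac]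
          congr 1
          ext m
          refine (coeff_degreeProj _ _ _).trans (if_pos ?_)
          rw [Subsingleton.elim m 0]
          simp
        · exact (hne _ J hJ).trans (hne _ J hJ).symm
      · funext J
        by_cases hJ : J = ∅
        · subst hJ
          rfl
        · exact hne _ J hJ
  | succ d ih =>
    -- `P / X_0 P` is the polynomial ring in the other variables, with `S` acting through `ψ'`; some
    -- `x j` of degree one acts on `P` as the regular element `X_0`.
    let ψ' := (killFirst k d).comp ψ
    let _ : Module S (MvPolynomial (Fin d) k) := Module.compHom _ ψ'
    have hψ' : ∀ (r : S) (p : MvPolynomial (Fin d) k), r • p = ψ' r * p := fun _ _ => rfl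
    have hx' : ∀ j, (ψ' (x j)).IsHomogeneous (e j) := fun j => (hx j).killFirst
    obtain ⟨ih1, ih2, ih3⟩ := ih ψ' hψ' hx'
      (fun j => by
        rw [← hc j]
        exact constantCoeff_killFirst _)
      (fun i => by
        obtain ⟨j, hj, hj1⟩ := hX i.succ
        exact ⟨j, by rw [RingHom.comp_apply, hj, killFirst_X_succ], hj1⟩)
    obtain ⟨j, hj, hj1⟩ := hX 0
    let g : MvPolynomial (Fin (d + 1)) k →ₗ[S] MvPolynomial (Fin d) k :=
      { toFun := killFirst k d
        map_add' := map_add _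
        map_smul' := fun r p => by rw [hψ, map_mul]; rfl }
    have hg : Function.Surjective g := killFirst_surjective
    have hreg : ∀ w : MvPolynomial (Fin (d + 1)) k, x j • w = 0 → w = 0 := by
      intro w hw
      rw [hψ, hj] at hw
      exact (mul_eq_zero.1 hw).resolve_left (X_ne_zero 0)
    have hker : ∀ w, g w = 0 → ∃ v, w = x j • v := by
      intro w hw
      obtain ⟨v, rfl⟩ := X_zero_dvd_of_killFirst_eq_zero hw
      exact ⟨v, by rw [hψ, hj]⟩
    have hg0 : ∀ w, g (x j • w) = 0 := by
      intro w
      rw [hψ, hj]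
      change killFirst k d _ = 0
      rw [map_mul, killFirst_X_zero, zero_mul]
    have hP : ∀ n w, g ((polyProj ψ hψ hx).π n w) = (polyProj ψ' hψ' hx').π n (g w) :=
      fun n w => killFirst_degreeProj n w
    have h1 : ∀ i n : ℤ, i ≠ (d + 1 : ℕ) → (polyProj ψ hψ hx).Vanish i n := fun i n hi =>
      .of_regular hreg hg hker hg0 hP fun l => ih1 _ _ (by push_cast at hi; omega)
    refine ⟨h1, ?_, ?_⟩
    · intro n hn
      refine .of_regular hreg hg hker hg0 hP fun l => ?_
      rw [Nat.cast_succ, add_sub_cancel_right]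
      refine ih2 _ ?_
      rw [hj1]
      push_cast at hn ⊢
      omega
    -- `H^d(P)` is zero, so `H^d(P / X_0 P)_{-d}` embeds into `H^{d+1}(P)_{-(d+1)}`; the shift by
    -- one is the degree of `X_0`.
    · have := Proj.not_vanish_of_connecting (P' := polyProj ψ hψ hx) (P := polyProj ψ hψ hx)
        (P'' := polyProj ψ' hψ' hx') (f := LinearMap.lsmul S _ (x j)) (g := g) (t := e j)
        ((injective_iff_map_eq_zero _).2 hreg) hg ?_
        (fun n w => ((polyProj ψ hψ hx).smul n j w).symm) hP (i := d) (n := -((d + 1 : ℕ) : ℤ))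
        (h1 _ _ (by push_cast; omega))
        (by
          rw [hj1]
          convert ih3 using 2
          push_cast
          ring)
      · simpa using this
      · intro w
        constructor
        · intro h
          obtain ⟨v, rfl⟩ := hker w h
          exact ⟨v, rfl⟩
        · rintro ⟨v, rfl⟩
          exact hg0 v

end Cech

namespace Cech

open AwayModule

/-! ### The Čech complex of the ring itself -/

section Ring

variable {S : Type*} [CommRing S] {s : ℕ} (x : Fin s → S)

/-- The localization of the ring, seen as the localization of a module. -/
noncomputable def locEquiv (J : Finset (Fin s)) : Loc x J ≃+ MLoc x S J where
  toFun z := z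
  invFun z := z
  left_inv _ := rfl
  right_inv _ := rfl
  map_add' _ _ := rfl

theorem locEquiv_mk (J : Finset (Fin s)) (a : S) (k : ℕ) :
    locEquiv x J (Localization.mk a ⟨(∏ j ∈ J, x j) ^ k, pow_mem (Submonoid.mem_powers _) k⟩) =
      frac _ a k := rfl

theorem locEquiv_symm_frac (J : Finset (Fin s)) (a : S) (k : ℕ) :
    (locEquiv x J).symm (frac _ a k) =
      Localization.mk a ⟨(∏ j ∈ J, x j) ^ k, pow_mem (Submonoid.mem_powers _) k⟩ := rfl

theorem locEquiv_res {I J : Finset (Fin s)} (h : I ⊆ J) (z : Loc x I) :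
    locEquiv x J (res x h z) = mres x h (locEquiv x I z) := by
  obtain ⟨a, k, hz⟩ := exists_frac (locEquiv x I z)
  rw [hz, mres_frac]
  obtain rfl : z = (locEquiv x I).symm (frac _ a k) := by rw [← hz, AddEquiv.symm_apply_apply]
  rw [locEquiv_symm_frac, ← AddEquiv.eq_symm_apply, locEquiv_symm_frac, Localization.mk_eq_mk',
    Localization.mk_eq_mk', res, IsLocalization.Away.lift, IsLocalization.lift_mk'_spec]
  rw [← IsLocalization.mk'_one (M := Submonoid.powers (∏ j ∈ J, x j)) _ a,
    ← IsLocalization.mk'_one (M := Submonoid.powers (∏ j ∈ J, x j)) _ ((∏ j ∈ I, x j) ^ k),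
    ← IsLocalization.mk'_mul, IsLocalization.mk'_eq_iff_eq]
  congr 1
  simp only [Submonoid.coe_mul, smul_eq_mul, Submonoid.coe_one]
  rw [← Finset.prod_sdiff h]
  ring

/-- Cochains of the ring, seen as cochains of a module. -/
noncomputable def totalEquiv : Total x ≃+ MTotal x S :=
  AddEquiv.piCongrRight (locEquiv x)

theorem totalEquiv_apply (c : Total x) (J : Finset (Fin s)) :
    totalEquiv x c J = locEquiv x J (c J) := rfl

theorem totalEquiv_differential (c : Total x) :
    totalEquiv x (differential x c) = mdiff x (totalEquiv x c) := by
  funext J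
  rw [totalEquiv_apply, mdiff_apply]
  change locEquiv x J (∑ j ∈ J, _) = _
  rw [map_sum]
  refine Finset.sum_congr rfl fun j _ => ?_
  rw [totalEquiv_apply, ← locEquiv_res]
  rcases Int.isUnit_iff.1 (IsUnit.pow (J.filter (· < j)).card (isUnit_one.neg : IsUnit (-1 : ℤ)))
    with h | h
  · rw [h, one_smul, one_smul]
  · rw [h, neg_one_smul, neg_one_smul, map_neg]

variable {x} {e : Fin s → ℕ} (𝒜 : ℕ → AddSubgroup S) (P : Proj x e S)

/-- The fractions with homogeneous numerator already exhaust the fixed points of the projection.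
Vanishing in negative degrees is needed because `𝒜` is indexed by `ℕ`: a numerator of negative
degree must be zero. -/
theorem locEquiv_mem_iff (h𝒜 : ∀ (m : ℕ) a, a ∈ 𝒜 m ↔ P.π m a = a)
    (hneg : ∀ n < 0, ∀ a, P.π n a = 0)
    (J : Finset (Fin s)) (n : ℤ) (z : Loc x J) :
    z ∈ locDegree 𝒜 x e J n ↔ P.loc J n (locEquiv x J z) = locEquiv x J z := by
  constructor
  · intro hz
    induction hz using AddSubgroup.closure_induction with
    | mem z hz =>
      obtain ⟨k, m, a, ha, hm, rfl⟩ := hz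
      rw [locEquiv_mk, Proj.loc_frac, ← hm, (h𝒜 m a).1 ha]
    | zero => rw [map_zero, map_zero]
    | add z z' _ _ h h' => rw [map_add, map_add, h, h']
    | neg z _ h => rw [map_neg, map_neg, h]
  · intro hz
    obtain ⟨a, k, ha⟩ := exists_frac (locEquiv x J z)
    rw [ha, Proj.loc_frac, ← ha] at hz
    rw [← (locEquiv x J).symm_apply_apply z, ← hz]
    rcases lt_or_ge (n + k * (∑ j ∈ J, e j : ℕ)) 0 with h | h
    · rw [hneg _ h, frac_zero, map_zero]
      exact zero_mem _
    · obtain ⟨m, hm⟩ := Int.eq_ofNat_of_zero_le h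
      refine AddSubgroup.subset_closure ⟨k, m, P.π m a, (h𝒜 m _).2 (P.idem _ _), hm.symm, ?_⟩
      rw [hm, locEquiv_symm_frac]

theorem mem_cochains_iff (h𝒜 : ∀ (m : ℕ) a, a ∈ 𝒜 m ↔ P.π m a = a)
    (hneg : ∀ n < 0, ∀ a, P.π n a = 0) (i n : ℤ) (c : Total x) :
    c ∈ cochains 𝒜 x e i n ↔
      Supp x i (totalEquiv x c) ∧ P.tot n (totalEquiv x c) = totalEquiv x c := by
  constructor
  · intro h
    exact ⟨fun J hJ => by rw [totalEquiv_apply, (h J).2 hJ, map_zero], funext fun J =>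
      (locEquiv_mem_iff 𝒜 P h𝒜 hneg J n (c J)).1 (h J).1⟩
  · rintro ⟨h, h'⟩ J
    exact ⟨(locEquiv_mem_iff 𝒜 P h𝒜 hneg J n (c J)).2 (congrFun h' J), fun hJ =>
      (locEquiv x J).map_eq_zero_iff.1 (h J hJ)⟩

/-- The bridge from the Čech cohomology of the statement to `Proj.Vanish`. The primitive in
`Proj.Vanish` has no prescribed degree; projecting it to degree `n` supplies one. -/
theorem nontrivial_cohomology_iff (h𝒜 : ∀ (m : ℕ) a, a ∈ 𝒜 m ↔ P.π m a = a)
    (hneg : ∀ n < 0, ∀ a, P.π n a = 0) (i n : ℤ) :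
    Nontrivial (Cohomology 𝒜 x e i n) ↔ ¬ P.Vanish i n := by
  rw [← not_subsingleton_iff_nontrivial, not_iff_not, QuotientAddGroup.subsingleton_iff,
    AddSubgroup.addSubgroupOf_eq_top]
  constructor
  · intro h c hc hcn hcd
    have hc' : (totalEquiv x).symm c ∈ cocycles 𝒜 x e i n := by
      refine ⟨(mem_cochains_iff 𝒜 P h𝒜 hneg i n _).2 ?_, ?_⟩
      · rw [AddEquiv.apply_symm_apply]
        exact ⟨hc, hcn⟩
      · refine (AddMonoidHom.mem_ker).2 ((totalEquiv x).injective ?_)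
        rw [totalEquiv_differential, AddEquiv.apply_symm_apply, hcd, map_zero]
    obtain ⟨b, hb, hbc⟩ := h hc'
    refine ⟨totalEquiv x b, ((mem_cochains_iff 𝒜 P h𝒜 hneg _ n _).1 hb).1, ?_⟩
    rw [← totalEquiv_differential, hbc, AddEquiv.apply_symm_apply]
  · rintro h c ⟨hc, hcd⟩
    obtain ⟨hcs, hcn⟩ := (mem_cochains_iff 𝒜 P h𝒜 hneg i n _).1 hc
    obtain ⟨b, hb, hbd⟩ := h (totalEquiv x c) hcs hcn
      (by rw [← totalEquiv_differential, AddMonoidHom.mem_ker.1 hcd, map_zero])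
    obtain ⟨b, hb, hbn, hbd⟩ := P.exists_tot_eq hb hcn hbd
    refine ⟨(totalEquiv x).symm b, (mem_cochains_iff 𝒜 P h𝒜 hneg _ n _).2 ?_,
      (totalEquiv x).injective ?_⟩
    · rw [AddEquiv.apply_symm_apply]
      exact ⟨hb, hbn⟩
    · rw [totalEquiv_differential, AddEquiv.apply_symm_apply, hbd]

end Ring

end Cech

/-! ### Regular local rings -/

namespace IsRegularLocalRing

open IsLocalRing

variable {A : Type*} [CommRing A]

/-- A part of a regular system of parameters defines a regular quotient. -/
theorem quotient_span [IsRegularLocalRing A] (T U : Finset A)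
    (h : Ideal.span (T ∪ U : Set A) = maximalIdeal A)
    (hcard : ((T.card + U.card : ℕ) : WithBot ℕ∞) ≤ ringKrullDim A) :
    IsRegularLocalRing (A ⧸ Ideal.span (T : Set A)) ∧
      ringKrullDim (A ⧸ Ideal.span (T : Set A)) = U.card := by
  have hT : (T : Set A) ⊆ maximalIdeal A := by
    rw [← h]
    exact (Set.subset_union_left).trans Ideal.subset_span
  have hne : Ideal.span (T : Set A) ≠ ⊤ := fun h1 =>
    (maximalIdeal.isMaximal A).ne_top (top_le_iff.1 (h1 ▸ Ideal.span_le.2 hT))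
  have : Nontrivial (A ⧸ Ideal.span (T : Set A)) := Ideal.Quotient.nontrivial_iff.2 hne
  have : IsLocalRing (A ⧸ Ideal.span (T : Set A)) :=
    .of_surjective' (Ideal.Quotient.mk _) Ideal.Quotient.mk_surjective
  have hmax : maximalIdeal (A ⧸ Ideal.span (T : Set A)) =
      Ideal.span (Ideal.Quotient.mk (Ideal.span (T : Set A)) '' U) := by
    rw [← map_maximalIdeal_of_surjective (Ideal.Quotient.mk _) Ideal.Quotient.mk_surjective, ← h,
      Ideal.span_union, Ideal.map_sup, Ideal.map_quotient_self, bot_sup_eq, Ideal.map_span]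
  have h1 : (maximalIdeal (A ⧸ Ideal.span (T : Set A))).spanFinrank ≤ U.card := by
    rw [hmax]
    refine (Submodule.spanFinrank_span_le_ncard_of_finite (U.finite_toSet.image _)).trans ?_
    exact (Set.ncard_image_le U.finite_toSet).trans (by simp)
  -- Dividing by `T` lowers the dimension by at most `#T`, so it stays at least `#U`, while the
  -- images of `U` generate the maximal ideal. Dimension and embedding dimension are thus squeezed
  -- together.
  have h2 : (U.card : WithBot ℕ∞) ≤ ringKrullDim (A ⧸ Ideal.span (T : Set A)) := by
    have h3 := hcard.trans (ringKrullDim_le_ringKrullDim_quotient_add_card T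
      (by rwa [ringJacobson_eq_maximalIdeal]))
    rw [add_comm, Nat.cast_add] at h3
    exact (ENat.WithBot.add_le_add_natCast_right_iff).1 h3
  have h4 := ringKrullDim_le_spanFinrank_maximalIdeal (A ⧸ Ideal.span (T : Set A))
  exact ⟨.of_spanFinrank_maximalIdeal_le _ ((Nat.cast_le.2 h1).trans h2),
    le_antisymm (h4.trans (Nat.cast_le.2 h1)) h2⟩

/-- An element of `m` outside of `m ^ 2` is part of a minimal system of generators of `m`. -/
theorem exists_span_insert_eq [IsLocalRing A] [IsNoetherianRing A] {x : A}
    (hx : x ∈ maximalIdeal A) (hx2 : x ∉ maximalIdeal A ^ 2) :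
    ∃ U : Finset A, Ideal.span (insert x (U : Set A)) = maximalIdeal A ∧
      U.card + 1 = Module.finrank (ResidueField A) (CotangentSpace A) := by
  classical
  let v : CotangentSpace A := (maximalIdeal A).toCotangent ⟨x, hx⟩
  have hv : v ≠ 0 := fun h => hx2 ((Ideal.toCotangent_eq_zero _ _).1 h)
  have hs : LinearIndepOn (ResidueField A) id {v} := LinearIndepOn.singleton hv
  let E := hs.extend (Set.subset_univ _)
  let b : Module.Basis E (ResidueField A) (CotangentSpace A) := Module.Basis.extend hs
  have hvE : v ∈ E := hs.subset_extend _ rfl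
  have hE : E.Finite := Module.Finite.finite_basis b
  -- Lifts of cotangent vectors, chosen so that the class `v` of `x` is lifted to `x` itself;
  -- Nakayama then gives generators containing `x`.
  let l : CotangentSpace A → maximalIdeal A := fun w =>
    if w = v then ⟨x, hx⟩ else (Ideal.toCotangent_surjective _ w).choose
  have hl : ∀ w, (maximalIdeal A).toCotangent (l w) = w := by
    intro w
    by_cases h : w = v
    · simp only [l, if_pos h]
      exact h.symm
    · simp only [l, if_neg h]
      exact (Ideal.toCotangent_surjective _ w).choose_spec
  have hinj : Function.Injective (fun w => (l w : A)) := fun w w' h => by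
    rw [← hl w, ← hl w', Subtype.ext h]
  have hspan : Ideal.span (Subtype.val '' (l '' E)) = maximalIdeal A := by
    refine (Submodule.span_val_image_eq_iff _ _).2 (CotangentSpace.span_image_eq_top_iff.1 ?_)
    rw [Set.image_image]
    simp only [hl, Set.image_id']
    rw [← b.span_eq]
    exact congrArg _ (Module.Basis.range_extend hs).symm
  refine ⟨(hE.toFinset.erase v).image (fun w => (l w : A)), ?_, ?_⟩
  · refine Eq.trans (congrArg _ ?_) hspan
    have hxv : x = (l v : A) := by simp [l]
    rw [Set.image_image, Finset.coe_image, Finset.coe_erase, hE.coe_toFinset]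
    nth_rw 1 [hxv]
    rw [← Set.image_insert_eq (f := fun w => (l w : A)), Set.insert_sdiff_singleton,
      Set.insert_eq_of_mem hvE]
  · rw [Finset.card_image_of_injective _ hinj, Finset.card_erase_add_one (by simpa using hvE),
      Module.finrank_eq_nat_card_basis b, Nat.card_coe_set_eq, Set.ncard_eq_toFinset_card E hE]

/-- A regular local ring is a domain. -/
theorem isDomain_of_ringKrullDim_eq (n : ℕ) (A : Type*) [CommRing A] [IsRegularLocalRing A]
    (hn : ringKrullDim A = n) : IsDomain A := by
  induction n generalizing A with
  | zero =>
    have h := (IsRegularLocalRing.iff_finrank_cotangentSpace A).1 inferInstance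
    rw [hn, Nat.cast_inj, finrank_cotangentSpace_eq_zero_iff] at h
    exact h.isDomain
  | succ n ih =>
    have hfin := (IsRegularLocalRing.iff_finrank_cotangentSpace A).1 inferInstance
    rw [hn, Nat.cast_inj] at hfin
    have hmin : maximalIdeal A ∉ minimalPrimes A := by
      intro h
      have h1 := maximalIdeal_height_eq_ringKrullDim (R := A)
      rw [Ideal.height_eq_zero_iff.2 h, hn] at h1
      norm_cast at h1
    have hsq : ¬ maximalIdeal A ≤ maximalIdeal A ^ 2 := by
      intro h
      have h1 : maximalIdeal A = ⊥ := Submodule.eq_bot_of_le_smul_of_le_jacobson_bot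
        (maximalIdeal A) _ (IsNoetherian.noetherian _) (by rwa [smul_eq_mul, ← sq])
        (jacobson_eq_maximalIdeal ⊥ bot_ne_top).ge
      have h2 := finrank_cotangentSpace_eq_zero_iff.2 (isField_iff_maximalIdeal_eq.2 h1)
      omega
    -- Prime avoidance, which tolerates the non-prime ideal `m ^ 2` alongside the minimal primes.
    obtain ⟨x, hx, hx'⟩ : ∃ x ∈ maximalIdeal A,
        ∀ q ∈ insert (maximalIdeal A ^ 2) (minimalPrimes A), x ∉ q := by
      by_contra hcon
      push Not at hcon
      have := (Ideal.subset_union_prime_finite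
        ((minimalPrimes.finite_of_isNoetherianRing A).insert (maximalIdeal A ^ 2))
        (f := id) (maximalIdeal A ^ 2) (maximalIdeal A ^ 2)
        (fun i hi h _ => ((Set.mem_insert_iff.1 hi).resolve_left h).1.1)
        (I := maximalIdeal A)).1 (fun x hx => by simpa using hcon x hx)
      obtain ⟨q, hq, hle⟩ := this
      rcases Set.mem_insert_iff.1 hq with rfl | hq
      · exact hsq hle
      · have := (maximalIdeal.isMaximal A).eq_of_le hq.1.1.ne_top hle
        exact hmin (this ▸ hq)
    obtain ⟨U, hU, hUc⟩ := exists_span_insert_eq hx (hx' _ (Set.mem_insert _ _))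
    obtain ⟨h1, h2⟩ := quotient_span {x} U (by simpa using hU)
      (by rw [hn, Finset.card_singleton, add_comm, hUc, hfin])
    have hUn : U.card = n := by omega
    have hdom := ih _ (h2.trans (by rw [hUn]))
    rw [Ideal.Quotient.isDomain_iff_prime, Finset.coe_singleton] at hdom
    -- The ideal `(x)` is prime by induction and contains a minimal prime `q` with `x ∉ q`. Any `x z
    -- ∈ q` has `z ∈ q`, so `q ≤ m q` and `q = 0` by Nakayama.
    obtain ⟨q, hq, hqx⟩ := Ideal.exists_minimalPrimes_le (bot_le : ⊥ ≤ Ideal.span {x})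
    have hxq : x ∉ q := hx' q (Set.mem_insert_of_mem _ hq)
    have hq0 : q = ⊥ := by
      refine Submodule.eq_bot_of_le_smul_of_le_jacobson_bot (maximalIdeal A) q
        (IsNoetherian.noetherian _) (fun y hy => ?_) (jacobson_eq_maximalIdeal ⊥ bot_ne_top).ge
      obtain ⟨z, rfl⟩ := Ideal.mem_span_singleton.1 (hqx hy)
      exact Submodule.smul_mem_smul hx ((hq.1.1.mem_or_mem hy).resolve_left hxq)
    have : (⊥ : Ideal A).IsPrime := hq0 ▸ hq.1.1
    exact IsDomain.of_bot_isPrime A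

/-! ### Regular systems of parameters -/

section Parameters

variable [IsRegularLocalRing A] {d : ℕ}

theorem spanFinrank_maximalIdeal_eq (hd : ringKrullDim A = d) :
    (maximalIdeal A).spanFinrank = d := by
  have := spanFinrank_maximalIdeal (R := A)
  rwa [hd, Nat.cast_inj] at this

/-- Otherwise `x i` is superfluous and `d - 1` elements generate the maximal ideal, against its
embedding dimension `d`. -/
theorem notMem_span_image (hd : ringKrullDim A = d) {x : Fin d → A}
    (hx : Ideal.span (Set.range x) = maximalIdeal A) {T : Set (Fin d)} {i : Fin d} (hi : i ∉ T) :
    x i ∉ Ideal.span (x '' T) := by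
  intro h
  have h1 : Ideal.span (x '' {i}ᶜ) = maximalIdeal A := by
    rw [← hx]
    refine le_antisymm (Ideal.span_mono (Set.image_subset_range _ _)) (Ideal.span_le.2 ?_)
    rintro _ ⟨j, rfl⟩
    by_cases hj : j = i
    · subst hj
      exact Ideal.span_mono (Set.image_mono (Set.subset_compl_singleton_iff.2 hi)) h
    · exact Ideal.subset_span ⟨j, hj, rfl⟩
  have h2 := spanFinrank_maximalIdeal_eq hd
  rw [← h1] at h2
  have h3 := Submodule.spanFinrank_span_le_ncard_of_finite (R := A)
    ((Set.toFinite ({i}ᶜ : Set (Fin d))).image x)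
  have h4 := Set.ncard_image_le (Set.toFinite ({i}ᶜ : Set (Fin d))) (f := x)
  have h5 := Set.ncard_add_ncard_compl ({i} : Set (Fin d))
  rw [Set.ncard_singleton, Nat.card_fin] at h5
  have h6 : (Submodule.span A (x '' {i}ᶜ)).spanFinrank = d := h2
  omega

/-- The quotient by a part of a regular system of parameters is again regular local, hence a domain.
-/
theorem isPrime_span_image (hd : ringKrullDim A = d) {x : Fin d → A}
    (hx : Ideal.span (Set.range x) = maximalIdeal A) (T : Set (Fin d)) :
    (Ideal.span (x '' T)).IsPrime := by
  classical
  have hT : T.Finite := Set.toFinite T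
  have hTc : (Tᶜ).Finite := Set.toFinite _
  obtain ⟨h1, h2⟩ := quotient_span (hT.toFinset.image x) (hTc.toFinset.image x)
    (by
      rw [Finset.coe_image, Finset.coe_image, hT.coe_toFinset, hTc.coe_toFinset,
        ← Set.image_union, Set.union_compl_self, Set.image_univ, hx]) (by
      rw [hd, Nat.cast_le]
      refine (add_le_add Finset.card_image_le Finset.card_image_le).trans ?_
      rw [← Set.ncard_eq_toFinset_card T hT, ← Set.ncard_eq_toFinset_card _ hTc,
        Set.ncard_add_ncard_compl, Nat.card_fin])
  have := isDomain_of_ringKrullDim_eq _ _ h2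
  rw [Ideal.Quotient.isDomain_iff_prime] at this
  simpa using this

theorem isWeaklyRegular_ofFn (hd : ringKrullDim A = d) {x : Fin d → A}
    (hx : Ideal.span (Set.range x) = maximalIdeal A) :
    RingTheory.Sequence.IsWeaklyRegular A (List.ofFn x) := by
  constructor
  intro i hi
  have hid : i < d := by simpa using hi
  have hI : Ideal.ofList (List.take i (List.ofFn x)) = Ideal.span (x '' {j | j.1 < i}) := by
    rw [Ideal.ofList]
    congr 1
    ext a
    simp only [Set.mem_ofPred_eq, List.mem_take_iff_getElem, List.getElem_ofFn, Set.mem_image,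
      List.length_ofFn]
    constructor
    · rintro ⟨j, hj, rfl⟩
      exact ⟨⟨j, by omega⟩, by simp; omega, rfl⟩
    · rintro ⟨j, hj, rfl⟩
      exact ⟨j.1, by omega, rfl⟩
  rw [isSMulRegular_quotient_iff_mem_of_smul_mem]
  intro a ha
  rw [smul_eq_mul, Ideal.mul_top, hI] at ha ⊢
  rw [List.getElem_ofFn, smul_eq_mul] at ha
  exact ((isPrime_span_image hd hx _).mem_or_mem ha).resolve_left
    (notMem_span_image hd hx (by simp))

end Parameters

end IsRegularLocalRing

/-! ### Forms in a regular sequence -/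

namespace MvPolynomial

variable {A : Type*} [CommRing A]

/-- Every member of the family is regular modulo the ideal generated by the following ones. -/
def RegularModTail : {r : ℕ} → (Fin r → A) → Prop
  | 0, _ => True
  | _ + 1, x => (∀ a, x 0 * a ∈ Ideal.span (Set.range (Fin.tail x)) →
      a ∈ Ideal.span (Set.range (Fin.tail x))) ∧ RegularModTail (Fin.tail x)

theorem IsHomogeneous.degree_eq {σ : Type*} {p : MvPolynomial σ A} {n : ℕ}
    (h : p.IsHomogeneous n) {m : σ →₀ ℕ} (hm : coeff m p ≠ 0) : m.degree = n := by
  rw [Finsupp.degree_eq_weight_one]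
  exact h hm

theorem isHomogeneous_of_degree {σ : Type*} {p : MvPolynomial σ A} {n : ℕ}
    (h : ∀ m, coeff m p ≠ 0 → m.degree = n) : p.IsHomogeneous n := by
  intro m hm
  rw [← h m hm, Finsupp.degree_eq_weight_one]
  rfl

theorem eval_mem_pow_succ {r n : ℕ} (x : Fin r → A) {F : MvPolynomial (Fin r) A}
    (hF : F.IsHomogeneous n) (h : ∀ m, coeff m F ∈ Ideal.span (Set.range x)) :
    eval x F ∈ Ideal.span (Set.range x) ^ (n + 1) := by
  rw [eval_eq', pow_succ']
  refine Ideal.sum_mem _ fun m hm => Ideal.mul_mem_mul (h m) ?_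
  rw [← hF.degree_eq (mem_support_iff.1 hm), Finsupp.degree_eq_sum, ← Finset.prod_pow_eq_pow_sum]
  exact Ideal.prod_mem_prod (fun i _ => Ideal.pow_mem_pow
    (Ideal.subset_span (Set.mem_range_self i)) _)

/-- This allows a form whose value lies in the next power of the ideal to be corrected, by one with
coefficients in the ideal, into a form that vanishes exactly at `x`. -/
theorem exists_coeff_mem_of_mem_pow_succ {r n : ℕ} (x : Fin r → A) {y : A}
    (hy : y ∈ Ideal.span (Set.range x) ^ (n + 1)) :
    ∃ F : MvPolynomial (Fin r) A, F.IsHomogeneous n ∧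
      (∀ m, coeff m F ∈ Ideal.span (Set.range x)) ∧ eval x F = y := by
  rw [pow_succ'] at hy
  refine Submodule.mul_induction_on hy ?_ ?_
  · intro a ha b hb
    obtain ⟨q, hq, rfl⟩ := (Ideal.mem_span_pow_iff_exists_isHomogeneous x b).1 hb
    refine ⟨C a * q, ?_, fun m => ?_, by simp⟩
    · simpa using (isHomogeneous_C _ a).mul hq
    · rw [coeff_C_mul]
      exact Ideal.mul_mem_right _ _ ha
  · rintro _ _ ⟨F, hF, hFc, rfl⟩ ⟨G, hG, hGc, rfl⟩
    exact ⟨F + G, hF.add hG, fun m => by rw [coeff_add]; exact add_mem (hFc m) (hGc m),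
      map_add _ _ _⟩

/-- The division with remainder by the first variable. -/
theorem exists_eq_X_zero_mul_add {r : ℕ} (F : MvPolynomial (Fin (r + 1)) A) :
    ∃ (H : MvPolynomial (Fin (r + 1)) A) (G : MvPolynomial (Fin r) A),
      F = X 0 * H + rename Fin.succ G ∧ (∀ m, coeff m G = coeff (Finsupp.cons 0 m) F) ∧
      ∀ i m, coeff (Finsupp.cons i m) H = coeff (Finsupp.cons (i + 1) m) F := by
  let p := finSuccEquiv A r F
  refine ⟨(finSuccEquiv A r).symm p.divX, p.coeff 0, (finSuccEquiv A r).injective ?_,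
    fun m => finSuccEquiv_coeff_coeff m F 0, fun i m => ?_⟩
  · have hC : finSuccEquiv A r (rename Fin.succ (p.coeff 0)) = Polynomial.C (p.coeff 0) := by
      generalize p.coeff 0 = q
      induction q using MvPolynomial.induction_on with
      | C a => simp [finSuccEquiv_apply]
      | add p q hp hq => rw [map_add, map_add, hp, hq, Polynomial.C_add]
      | mul_X p i hp =>
        rw [map_mul, map_mul, hp, rename_X, finSuccEquiv_X_succ, Polynomial.C_mul]
    rw [map_add, map_mul, finSuccEquiv_X_zero, AlgEquiv.apply_symm_apply, hC, mul_comm,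
      Polynomial.divX_mul_X_add]
  · rw [← finSuccEquiv_coeff_coeff, AlgEquiv.apply_symm_apply, Polynomial.coeff_divX,
      finSuccEquiv_coeff_coeff]

/-- A form which vanishes at a regular sequence, up to terms of higher order, has its
coefficients in the ideal generated by the sequence. -/
theorem coeff_mem_of_eval_mem_pow_succ {r : ℕ} (x : Fin r → A) (hx : RegularModTail x) (n : ℕ)
    (F : MvPolynomial (Fin r) A) (hF : F.IsHomogeneous n)
    (h : eval x F ∈ Ideal.span (Set.range x) ^ (n + 1)) (m : Fin r →₀ ℕ) :
    coeff m F ∈ Ideal.span (Set.range x) := by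
  induction r generalizing n with
  | zero =>
    by_cases hm : coeff m F = 0
    · rw [hm]
      exact zero_mem _
    · obtain rfl : n = 0 := by
        rw [← hF.degree_eq hm, Subsingleton.elim m 0, map_zero]
      rw [eq_C_of_isEmpty F, eval_C, zero_add, pow_one] at h
      rwa [Subsingleton.elim m 0]
  | succ r ih =>
    obtain ⟨hx0, hxt⟩ := hx
    have hle : Ideal.span (Set.range (Fin.tail x)) ≤ Ideal.span (Set.range x) :=
      Ideal.span_mono (by rintro _ ⟨i, rfl⟩; exact ⟨i.succ, rfl⟩)
    -- `x 0` is regular modulo every power of the tail ideal, not only the first: write `a` as a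
    -- form of degree `n` in the tail and apply the induction on `r` to `x 0` times that form.
    have hpow : ∀ n a, x 0 * a ∈ Ideal.span (Set.range (Fin.tail x)) ^ n →
        a ∈ Ideal.span (Set.range (Fin.tail x)) ^ n := by
      intro n
      induction n with
      | zero => simp
      | succ n ihn =>
        intro a ha
        obtain ⟨G, hG, rfl⟩ := (Ideal.mem_span_pow_iff_exists_isHomogeneous _ a).1
          (ihn a (Ideal.pow_le_pow_right n.le_succ ha))
        refine eval_mem_pow_succ _ hG fun m => hx0 _ ?_
        rw [← coeff_C_mul]
        exact ih (Fin.tail x) hxt n (C (x 0) * G) (by simpa using (isHomogeneous_C _ _).mul hG)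
          (by simpa using ha) m
    suffices key : ∀ n (F : MvPolynomial (Fin (r + 1)) A), F.IsHomogeneous n → eval x F = 0 →
        ∀ m, coeff m F ∈ Ideal.span (Set.range x) by
      obtain ⟨F', hF', hF'c, hF'x⟩ := exists_coeff_mem_of_mem_pow_succ x h
      have := key n (F - F') (hF.sub hF') (by rw [map_sub, hF'x, sub_self]) m
      rw [coeff_sub] at this
      simpa using add_mem this (hF'c m)
    intro n
    induction n with
    | zero =>
      intro F hF hF0 m
      have hC : F = C (coeff 0 F) := by
        rw [← totalDegree_eq_zero_iff_eq_C]
        exact Nat.le_zero.1 hF.totalDegree_le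
      rw [hC, eval_C] at hF0
      rw [hC, hF0, C_0, coeff_zero]
      exact zero_mem _
    | succ n ihn =>
      intro F hF hF0 m
      obtain ⟨H, G, hHG, hGc, hHc⟩ := exists_eq_X_zero_mul_add F
      have hG : G.IsHomogeneous (n + 1) := isHomogeneous_of_degree fun m hm => by
        rw [hGc] at hm
        rw [← hF.degree_eq hm, degree_cons_zero]
      have hH : H.IsHomogeneous n := isHomogeneous_of_degree fun m hm => by
        rw [← Finsupp.cons_tail m, hHc] at hm
        have h1 := hF.degree_eq hm
        rw [← Finsupp.cons_tail m]
        simp only [Finsupp.degree_eq_sum, Fin.sum_univ_succ, Finsupp.cons_zero,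
          Finsupp.cons_succ] at h1 ⊢
        omega
      have heval : x 0 * eval x H + eval (Fin.tail x) G = 0 := by
        rw [hHG, map_add, map_mul, eval_X, eval_rename] at hF0
        exact hF0
      -- From `F = X_0 H + G` and `F(x) = 0`, the element `x_0 H(x) = -G` lies in a power of the
      -- tail ideal, and `x_0` can be cancelled. This puts `H` under the induction on the degree.
      have hHx : eval x H ∈ Ideal.span (Set.range (Fin.tail x)) ^ (n + 1) := by
        apply hpow
        rw [eq_neg_of_add_eq_zero_left heval]
        exact neg_mem ((Ideal.mem_span_pow_iff_exists_isHomogeneous _ _).2 ⟨G, hG, rfl⟩)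
      have hHm : ∀ m, coeff m H ∈ Ideal.span (Set.range x) := by
        intro m
        obtain ⟨F', hF', hF'c, hF'x⟩ := exists_coeff_mem_of_mem_pow_succ x
          (Ideal.pow_right_mono hle _ hHx)
        have := ihn (H - F') (hH.sub hF') (by rw [map_sub, hF'x, sub_self]) m
        rw [coeff_sub] at this
        simpa using add_mem this (hF'c m)
      obtain ⟨q, hq, hqx⟩ := (Ideal.mem_span_pow_iff_exists_isHomogeneous _ _).1 hHx
      have hGm : ∀ m, coeff m G ∈ Ideal.span (Set.range x) := by
        intro m
        -- Writing `H(x) = q(tail x)`, the form `x_0 q + G` vanishes at the tail, so its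
        -- coefficients lie in the tail ideal; those of `x_0 q` lie in `(x)` because `x_0` does.
        have h1 := ih (Fin.tail x) hxt (n + 1) (C (x 0) * q + G)
          ((by simpa using (isHomogeneous_C _ (x 0)).mul hq : IsHomogeneous _ _).add hG)
          (by
            rw [map_add, map_mul, eval_C, hqx, heval]
            exact zero_mem _) m
        rw [coeff_add, coeff_C_mul] at h1
        have h2 := sub_mem (hle h1) (Ideal.mul_mem_right (coeff m q) _
          (Ideal.subset_span (Set.mem_range_self (f := x) 0)))
        simpa using h2
      rw [← Finsupp.cons_tail m]
      rcases hm0 : m 0 with _ | i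
      · rw [← hGc]
        exact hGm _
      · rw [← hHc]
        exact hHm _

end MvPolynomial

/-- The induction runs over all injective reindexings, so that the tail is again of the same kind;
each step holds because the tail generates a prime ideal missing the first element. -/
theorem IsRegularLocalRing.regularModTail {A : Type*} [CommRing A] [IsRegularLocalRing A] {d : ℕ}
    (hd : ringKrullDim A = d) {x : Fin d → A}
    (hx : Ideal.span (Set.range x) = IsLocalRing.maximalIdeal A) :
    MvPolynomial.RegularModTail x := by
  suffices key : ∀ (r : ℕ) (f : Fin r → Fin d), Function.Injective f →
      MvPolynomial.RegularModTail (x ∘ f) from key d id Function.injective_id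
  intro r
  induction r with
  | zero => exact fun _ _ => trivial
  | succ r ih =>
    intro f hf
    refine ⟨fun a ha => ?_, ih (f ∘ Fin.succ) (hf.comp (Fin.succ_injective r))⟩
    have h1 : Set.range (Fin.tail (x ∘ f)) = x '' Set.range (f ∘ Fin.succ) := by
      rw [← Set.range_comp]
      rfl
    rw [h1] at ha ⊢
    refine ((isPrime_span_image hd hx _).mem_or_mem ha).resolve_left
      (notMem_span_image hd hx ?_)
    rintro ⟨j, hj⟩
    exact Fin.succ_ne_zero j (hf hj)

/-! ### Initial forms in the associated graded ring -/

/-- A copy of the associated graded ring `G_I(R)`, which hides its construction as a direct sum. -/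
def Gr {R : Type*} [CommRing R] (I : Ideal R) : Type _ := AssocGradedRing I

noncomputable instance {R : Type*} [CommRing R] (I : Ideal R) : CommRing (Gr I) :=
  inferInstanceAs (CommRing (AssocGradedRing I))

namespace AssocGraded

section

variable {R : Type*} [CommRing R] (I : Ideal R)

/-- The inclusion of the component of degree `n`. -/
noncomputable def incl (n : ℕ) : Piece I n →+ Gr I :=
  AddMonoidHom.mk' (fun z => (DirectSum.of (Piece I) n z : AssocGradedRing I))
    (fun a b => (DirectSum.of (Piece I) n).map_add a b)

/-- Additive maps on the components define an additive map on the associated graded ring. -/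
noncomputable def sumLift {T : Type*} [AddCommGroup T] (φ : ∀ n, Piece I n →+ T) : Gr I →+ T :=
  AddMonoidHom.mk' (fun z => DirectSum.toAddMonoid φ (z : AssocGradedRing I))
    (fun a b => (DirectSum.toAddMonoid φ).map_add a b)

theorem sumLift_incl {T : Type*} [AddCommGroup T] (φ : ∀ n, Piece I n →+ T) (n : ℕ)
    (z : Piece I n) : sumLift I φ (incl I n z) = φ n z := DirectSum.toAddMonoid_of φ n z

theorem incl_injective (n : ℕ) : Function.Injective (incl I n) :=
  DirectSum.of_injective (β := Piece I) n

theorem incl_mul {i j : ℕ} (a : Piece I i) (b : Piece I j) :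
    incl I i a * incl I j b = incl I (i + j) (pieceMul I i j a b) :=
  DirectSum.of_mul_of a b

theorem incl_one : incl I 0 (mk I 0 1 (by simp)) = 1 := rfl

theorem incl_induction {p : Gr I → Prop} (z : Gr I) (zero : p 0)
    (incl : ∀ n z, p (incl I n z)) (add : ∀ z w, p z → p w → p (z + w)) : p z :=
  DirectSum.induction_on (motive := p) z zero incl add

/-- The class of an element of `I ^ n` in the component of degree `n` of `G_I(R)`. -/
noncomputable def form (n : ℕ) (a : R) (ha : a ∈ I ^ n) : Gr I := incl I n (mk I n a ha)

/-- The component of degree `n`. -/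
def grComponent (n : ℕ) : AddSubgroup (Gr I) := component I n

variable {I}

theorem form_congr {i j : ℕ} (hij : i = j) {a b : R} (hab : a = b) (ha : a ∈ I ^ i)
    (hb : b ∈ I ^ j) : form I i a ha = form I j b hb := by
  subst hij hab; rfl

theorem form_mul {i j : ℕ} {a b : R} (ha : a ∈ I ^ i) (hb : b ∈ I ^ j) :
    form I i a ha * form I j b hb =
      form I (i + j) (a * b) (by rw [pow_add]; exact Ideal.mul_mem_mul ha hb) :=
  incl_mul I _ _

theorem form_add {n : ℕ} {a b : R} (ha : a ∈ I ^ n) (hb : b ∈ I ^ n) :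
    form I n a ha + form I n b hb = form I n (a + b) (add_mem ha hb) :=
  (map_add (incl I n) _ _).symm

theorem form_eq_zero {n : ℕ} {a : R} (ha : a ∈ I ^ n) :
    form I n a ha = 0 ↔ a ∈ I ^ (n + 1) := by
  rw [form, ← map_zero (incl I n), (incl_injective I n).eq_iff, mk, Submodule.Quotient.mk_eq_zero]
  rfl

theorem form_zero (n : ℕ) : form I n 0 (zero_mem _) = 0 := (form_eq_zero _).2 (zero_mem _)

theorem form_one : form I 0 1 (by simp) = 1 := incl_one I

@[elab_as_elim]
theorem induction_on {p : Gr I → Prop} (z : Gr I)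
    (form : ∀ n a ha, p (form I n a ha)) (add : ∀ z w, p z → p w → p (z + w)) : p z := by
  refine incl_induction I z (by rw [← form_zero 0]; exact form _ _ _) (fun n z => ?_) add
  obtain ⟨a, ha, rfl⟩ := exists_mk I z
  exact form n a ha

theorem mem_component_iff {n : ℕ} {z : Gr I} :
    z ∈ grComponent I n ↔ ∃ a ha, z = form I n a ha := by
  constructor
  · rintro ⟨z, rfl⟩
    obtain ⟨a, ha, rfl⟩ := exists_mk I z
    exact ⟨a, ha, rfl⟩
  · rintro ⟨a, ha, rfl⟩
    exact ⟨_, rfl⟩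

variable (I) in
/-- The projection onto the component of degree `n : ℤ`. -/
noncomputable def degreeProj (n : ℤ) : Gr I →+ Gr I :=
  sumLift I fun m => if (m : ℤ) = n then incl I m else 0

theorem degreeProj_form (n : ℤ) (m : ℕ) (a : R) (ha : a ∈ I ^ m) :
    degreeProj I n (form I m a ha) = if (m : ℤ) = n then form I m a ha else 0 := by
  rw [degreeProj, form, sumLift_incl]
  split_ifs <;> rfl

theorem degreeProj_idem (n : ℤ) (z : Gr I) :
    degreeProj I n (degreeProj I n z) = degreeProj I n z := by
  induction z using AssocGraded.induction_on with
  | form m a ha =>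
    rw [degreeProj_form]
    split_ifs with h
    · rw [degreeProj_form, if_pos h]
    · rw [map_zero]
  | add z w hz hw => rw [map_add, map_add, hz, hw]

theorem degreeProj_mul {e : ℕ} {y : Gr I} (hy : y ∈ grComponent I e) (n : ℤ)
    (z : Gr I) : degreeProj I (n + e) (y * z) = y * degreeProj I n z := by
  obtain ⟨b, hb, rfl⟩ := mem_component_iff.1 hy
  induction z using AssocGraded.induction_on with
  | form m a ha =>
    rw [form_mul, degreeProj_form, degreeProj_form, mul_ite, mul_zero, form_mul]
    have : ((e + m : ℕ) : ℤ) = n + e ↔ (m : ℤ) = n := by push_cast; omega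
    simp only [this]
  | add z w hz hw => rw [mul_add, map_add, hz, hw, map_add, mul_add]

theorem degreeProj_mem_component (n : ℕ) (z : Gr I) :
    degreeProj I n z ∈ grComponent I n := by
  induction z using AssocGraded.induction_on with
  | form m a ha =>
    rw [degreeProj_form]
    split_ifs with h
    · obtain rfl : m = n := by exact_mod_cast h
      exact mem_component_iff.2 ⟨a, ha, rfl⟩
    · exact zero_mem _
  | add z w hz hw => rw [map_add]; exact add_mem hz hw

theorem mem_component_iff_degreeProj {n : ℕ} {z : Gr I} :
    z ∈ grComponent I n ↔ degreeProj I n z = z := by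
  constructor
  · intro h
    obtain ⟨a, ha, rfl⟩ := mem_component_iff.1 h
    rw [degreeProj_form, if_pos rfl]
  · intro h
    rw [← h]
    exact degreeProj_mem_component n z

theorem degreeProj_of_neg {n : ℤ} (hn : n < 0) (z : Gr I) :
    degreeProj I n z = 0 := by
  induction z using AssocGraded.induction_on with
  | form m a ha => rw [degreeProj_form, if_neg (by omega)]
  | add z w hz hw => rw [map_add, hz, hw, add_zero]

end

/-! ### Functoriality -/

section Map

variable {R A : Type*} [CommRing R] [CommRing A] {I : Ideal R} {J : Ideal A} (f : R →+* A)
  (hf : I.map f ≤ J)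

theorem map_mem_pow (hf : I.map f ≤ J) {n : ℕ} {a : R} (ha : a ∈ I ^ n) : f a ∈ J ^ n :=
  Ideal.pow_right_mono hf n (Ideal.map_pow f I n ▸ Ideal.mem_map_of_mem f ha)

/-- The map `I ^ n / I ^ (n + 1) → J ^ n / J ^ (n + 1)`. -/
def pieceMap (n : ℕ) : Piece I n →ₛₗ[f] Piece J n :=
  Submodule.mapQ _ _
    { toFun := fun a : ↥(I ^ n) => (⟨f a, map_mem_pow f hf a.2⟩ : ↥(J ^ n))
      map_add' := fun _ _ => Subtype.ext (map_add f _ _)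
      map_smul' := fun _ _ => Subtype.ext (map_mul f _ _) }
    (fun a (ha : (a : R) ∈ I ^ (n + 1)) => (map_mem_pow f hf ha : f a ∈ J ^ (n + 1)))

/-- The additive map of associated graded rings induced by a ring homomorphism. -/
noncomputable def gradedAddMap : Gr I →+ Gr J :=
  sumLift I fun n => (incl J n).comp (pieceMap f hf n).toAddMonoidHom

theorem gradedAddMap_form (n : ℕ) (a : R) (ha : a ∈ I ^ n) :
    gradedAddMap f hf (form I n a ha) = form J n (f a) (map_mem_pow f hf ha) := by
  rw [gradedAddMap, form, sumLift_incl]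
  rfl

theorem gradedAddMap_mul (z w : Gr I) :
    gradedAddMap f hf (z * w) = gradedAddMap f hf z * gradedAddMap f hf w := by
  induction z using AssocGraded.induction_on with
  | form i a ha =>
    induction w using AssocGraded.induction_on with
    | form j b hb =>
      rw [form_mul, gradedAddMap_form, gradedAddMap_form, gradedAddMap_form, form_mul]
      exact form_congr rfl (map_mul f a b) _ _
    | add w w' hw hw' => rw [mul_add, map_add, hw, hw', map_add, mul_add]
  | add z z' hz hz' => rw [add_mul, map_add, hz, hz', map_add, add_mul]

/-- The homomorphism of associated graded rings induced by a ring homomorphism. -/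
noncomputable def gradedMap : Gr I →+* Gr J :=
  { gradedAddMap f hf with
    map_one' := (gradedAddMap_form f hf 0 1 _).trans
      ((form_congr rfl (map_one f) _ _).trans form_one)
    map_mul' := gradedAddMap_mul f hf }

theorem gradedMap_form (n : ℕ) (a : R) (ha : a ∈ I ^ n) :
    gradedMap f hf (form I n a ha) = form J n (f a) (map_mem_pow f hf ha) :=
  gradedAddMap_form f hf n a ha

theorem gradedMap_degreeProj (n : ℤ) (z : Gr I) :
    gradedMap f hf (degreeProj I n z) = degreeProj J n (gradedMap f hf z) := by
  induction z using AssocGraded.induction_on with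
  | form m a ha =>
    rw [degreeProj_form, gradedMap_form, degreeProj_form]
    split_ifs
    · rw [gradedMap_form]
    · rw [map_zero]
  | add z w hz hw => rw [map_add, map_add, hz, hw, map_add, map_add]

end Map

/-! ### Presentation by a polynomial ring -/

section Presentation

variable {R : Type*} [CommRing R] (I : Ideal R)

/-- The map `R → G_I(R)` with image the component of degree `0`. -/
noncomputable def baseMap : R →+* Gr I where
  toFun r := form I 0 r (by simp)
  map_one' := form_one
  map_zero' := form_zero 0
  map_mul' _ _ := by rw [form_mul]
  map_add' _ _ := (form_add _ _).symm

theorem baseMap_apply (r : R) : baseMap I r = form I 0 r (by simp) := rfl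

variable {I} {ι : Type*} {g : ι → R} (hg : ∀ i, g i ∈ I)

/-- The homomorphism `R[X_i] → G_I(R)` which maps `X_i` to the form of degree `1` of `g i`. -/
noncomputable def polyMap : MvPolynomial ι R →+* Gr I :=
  MvPolynomial.eval₂Hom (baseMap I) fun i => form I 1 (g i) (by simpa using hg i)

theorem polyMap_X (i : ι) : polyMap hg (MvPolynomial.X i) = form I 1 (g i) (by simpa using hg i) :=
  MvPolynomial.eval₂Hom_X' _ _ _

theorem polyMap_C (r : R) : polyMap hg (MvPolynomial.C r) = baseMap I r :=
  MvPolynomial.eval₂Hom_C _ _ _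

theorem polyMap_surjective (hI : Ideal.span (Set.range g) = I) :
    Function.Surjective (polyMap hg) := by
  have h1 : ∀ b (hb : b ∈ I), form I 1 b (by simpa using hb) ∈ (polyMap hg).range := by
    intro b hb
    have hb' := hb
    rw [← hI] at hb'
    induction hb' using Submodule.span_induction with
    | mem b h =>
      obtain ⟨i, rfl⟩ := h
      exact ⟨_, polyMap_X hg i⟩
    | zero => rw [form_zero]; exact zero_mem _
    | add b c hb' hc' hb'' hc'' =>
      have h1 := add_mem (hb'' (hI ▸ hb')) (hc'' (hI ▸ hc'))
      rwa [form_add] at h1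
    | smul r b hb' hb'' =>
      have h1 := mul_mem (⟨_, polyMap_C hg r⟩ : baseMap I r ∈ (polyMap hg).range) (hb'' (hI ▸ hb'))
      rw [baseMap_apply, form_mul] at h1
      convert h1 using 1
      exact form_congr (by rw [zero_add]) rfl _ _
  have h2 : ∀ n a (ha : a ∈ I ^ n), form I n a ha ∈ (polyMap hg).range := by
    intro n
    induction n with
    | zero => exact fun a ha => ⟨_, polyMap_C hg a⟩
    | succ n ih =>
      intro a ha
      have ha' := ha
      rw [pow_succ] at ha'
      induction ha' using Submodule.mul_induction_on' with
      | mem_mul_mem a ha' b hb =>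
        have h := mul_mem (ih a ha') (h1 b hb)
        rwa [form_mul] at h
      | add a ha' b hb' ha'' hb'' =>
        have h := add_mem (ha'' (by rwa [pow_succ])) (hb'' (by rwa [pow_succ]))
        rwa [form_add] at h
  intro z
  change z ∈ (polyMap hg).range
  induction z using AssocGraded.induction_on with
  | form n a ha => exact h2 n a ha
  | add z w hz hw => exact add_mem hz hw

instance isNoetherianRing [IsNoetherianRing R] : IsNoetherianRing (Gr I) := by
  obtain ⟨s, hs⟩ := IsNoetherian.noetherian I
  have hg : ∀ i : s, (i : R) ∈ I := fun i => hs ▸ Submodule.subset_span i.2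
  exact isNoetherianRing_of_surjective _ _ (polyMap hg) (polyMap_surjective hg (by
    rw [Subtype.range_coe]; exact hs))

theorem prod_mem_pow_degree (hg : ∀ i, g i ∈ I) (m : ι →₀ ℕ) (c : R) :
    c * (m.prod fun i k => g i ^ k) ∈ I ^ m.degree := by
  refine Ideal.mul_mem_left _ _ ?_
  rw [Finsupp.prod, Finsupp.degree_apply, ← Finset.prod_pow_eq_pow_sum]
  exact Ideal.prod_mem_prod (fun i _ => Ideal.pow_mem_pow (hg i) _)

theorem polyMap_monomial (m : ι →₀ ℕ) (c : R) :
    polyMap hg (MvPolynomial.monomial m c) =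
      form I m.degree (c * (m.prod fun i k => g i ^ k)) (prod_mem_pow_degree hg m c) := by
  induction m using Finsupp.induction_linear generalizing c with
  | zero =>
    refine (polyMap_C hg c).trans ?_
    rw [baseMap_apply]
    exact form_congr (by simp) (by simp) _ _
  | add m m' hm hm' =>
    have : MvPolynomial.monomial (m + m') c =
      MvPolynomial.monomial m c * MvPolynomial.monomial m' 1 := by
      rw [MvPolynomial.monomial_mul, mul_one]
    rw [this, map_mul, hm, hm', form_mul]
    refine form_congr (map_add _ _ _).symm ?_ _ _
    rw [Finsupp.prod_add_index' (by simp) (fun _ _ _ => pow_add _ _ _)]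
    ring
  | single i k =>
    have : ∀ k, polyMap hg (MvPolynomial.X i ^ k) =
        form I k (g i ^ k) (Ideal.pow_mem_pow (hg i) k) := by
      intro k
      induction k with
      | zero => rw [pow_zero, map_one, ← form_one]; exact form_congr rfl (by simp) _ _
      | succ k ih =>
        rw [pow_succ, map_mul, ih, polyMap_X, form_mul]
        exact form_congr rfl (by rw [pow_succ]) _ _
    rw [← MvPolynomial.C_mul_X_pow_eq_monomial, map_mul, this, polyMap_C, baseMap_apply, form_mul]
    exact form_congr (by simp) (by simp) _ _

theorem polyMap_degreeProj (n : ℤ) (F : MvPolynomial ι R) :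
    polyMap hg (MvPolynomial.degreeProj n F) = degreeProj I n (polyMap hg F) := by
  induction F using MvPolynomial.induction_on' with
  | monomial m c =>
    have : MvPolynomial.degreeProj n (MvPolynomial.monomial m c) =
        if (m.degree : ℤ) = n then MvPolynomial.monomial m c else 0 := by
      classical
      ext m'
      rw [MvPolynomial.coeff_degreeProj]
      by_cases hm : m = m'
      · subst hm
        split_ifs <;> simp
      · split_ifs <;> simp [MvPolynomial.coeff_monomial, hm]
    rw [this, polyMap_monomial, degreeProj_form]
    split_ifs
    · rw [polyMap_monomial]
    · rw [map_zero]
  | add p q hp hq => rw [map_add, map_add, hp, hq, map_add, map_add]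

theorem eval_mem_pow (hg : ∀ i, g i ∈ I) {n : ℕ} {F : MvPolynomial ι R}
    (hF : F.IsHomogeneous n) : MvPolynomial.eval g F ∈ I ^ n := by
  rw [MvPolynomial.eval_eq]
  refine Ideal.sum_mem _ fun m hm => ?_
  have := prod_mem_pow_degree hg m (MvPolynomial.coeff m F)
  rwa [hF.degree_eq (MvPolynomial.mem_support_iff.1 hm)] at this

/-- With this, a form maps to zero in `G_I(R)` exactly when its value lies in `I ^ (n + 1)`. -/
theorem polyMap_of_isHomogeneous {n : ℕ} {F : MvPolynomial ι R} (hF : F.IsHomogeneous n) :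
    polyMap hg F = form I n (MvPolynomial.eval g F) (eval_mem_pow hg hF) := by
  have key : ∀ s : Finset (ι →₀ ℕ), s ⊆ F.support →
      ∃ h, polyMap hg (∑ m ∈ s, MvPolynomial.monomial m (F.coeff m)) =
        form I n (MvPolynomial.eval g (∑ m ∈ s, MvPolynomial.monomial m (F.coeff m))) h := by
    classical
    intro s
    induction s using Finset.induction_on with
    | empty => exact fun _ => ⟨by simp, by simpa using (form_zero n).symm⟩
    | insert m s hm ih =>
      intro hs
      obtain ⟨h, ih⟩ := ih ((Finset.subset_insert m s).trans hs)
      have hdeg : m.degree = n :=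
        hF.degree_eq (MvPolynomial.mem_support_iff.1 (hs (Finset.mem_insert_self m s)))
      have h' := prod_mem_pow_degree hg m (F.coeff m)
      rw [hdeg] at h'
      rw [Finset.sum_insert hm]
      simp only [map_add, ih, MvPolynomial.eval_monomial]
      refine ⟨add_mem h' h, ?_⟩
      rw [polyMap_monomial, form_congr hdeg rfl _ h', form_add]
  obtain ⟨h, hk⟩ := key F.support subset_rfl
  conv_lhs => rw [MvPolynomial.as_sum F]
  exact hk.trans (form_congr rfl (by rw [← MvPolynomial.as_sum]) _ _)

end Presentation

end AssocGraded

/-! ### Depth -/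

section Depth

open CategoryTheory Abelian RingTheory.Sequence IsLocalRing

theorem IsLocalRing.maximalIdeal_smul_top_lt {R : Type*} [CommRing R] [IsLocalRing R]
    (W : Type*) [AddCommGroup W] [Module R W] [Module.Finite R W] [Nontrivial W] :
    maximalIdeal R • (⊤ : Submodule R W) < ⊤ := by
  refine lt_top_iff_ne_top.2 fun h => ?_
  have h1 := Submodule.eq_bot_of_le_smul_of_le_jacobson_bot (maximalIdeal R) ⊤
    Module.Finite.fg_top h.ge (IsLocalRing.maximalIdeal_le_jacobson _)
  exact bot_ne_top h1.symm

universe v u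

/-- Depth is detected by the vanishing of `Ext` from the residue field. -/
theorem le_moduleDepth_iff {R : Type u} [CommRing R] [IsLocalRing R] [IsNoetherianRing R]
    [Small.{v} R] (W : ModuleCat.{v} R) [Module.Finite R W] [Nontrivial W] (n : ℕ) :
    (n : ℕ∞) ≤ moduleDepth R W ↔
      ∀ i < n, Subsingleton (Ext (ModuleCat.of R (Shrink.{v} (R ⧸ maximalIdeal R))) W i) := by
  have tfae := fun n => ModuleCat.exists_isRegular_tfae (maximalIdeal R) n W
    (maximalIdeal_smul_top_lt W)
  constructor
  · intro h i hi
    -- Treating one `i` at a time, a regular sequence longer than `i` is enough, and the supremum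
    -- need not be attained.
    have h1 : (i : ℕ∞) < moduleDepth R W := lt_of_lt_of_le (by exact_mod_cast hi) h
    obtain ⟨rs, h1⟩ := lt_iSup_iff.1 h1
    obtain ⟨hrs, h1⟩ := lt_iSup_iff.1 h1
    have h2 := (tfae rs.length).out 3 1
    exact h2.1 ⟨rs, rfl, hrs⟩ i (by exact_mod_cast h1)
  · intro h
    obtain ⟨rs, hlen, hrs⟩ := ((tfae n).out 1 3).1 h
    rw [← hlen]
    exact le_iSup₂_of_le rs hrs le_rfl

/-- In a short exact sequence whose last term has larger depth than its first one, the middle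
term has the depth of the first one. -/
theorem moduleDepth_eq_of_exact {R : Type u} [CommRing R] [IsLocalRing R] [IsNoetherianRing R]
    [Small.{v} R] {W₁ W₂ W₃ : Type v} [AddCommGroup W₁] [AddCommGroup W₂] [AddCommGroup W₃]
    [Module R W₁] [Module R W₂] [Module R W₃] [Module.Finite R W₁] [Module.Finite R W₂]
    [Module.Finite R W₃] [Nontrivial W₁] [Nontrivial W₂] [Nontrivial W₃]
    (f : W₁ →ₗ[R] W₂) (g : W₂ →ₗ[R] W₃) (hf : Function.Injective f) (hg : Function.Surjective g)
    (hfg : Function.Exact f g) (h : moduleDepth R W₁ < moduleDepth R W₃) :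
    moduleDepth R W₂ = moduleDepth R W₁ := by
  have hS : (ShortComplex.mk (ModuleCat.ofHom f) (ModuleCat.ofHom g) (by
      ext w; exact hfg.apply_apply_eq_zero w)).ShortExact :=
    { exact := by
        rw [ShortComplex.ShortExact.moduleCat_exact_iff_function_exact]
        exact hfg
      mono_f := (ModuleCat.mono_iff_injective _).2 hf
      epi_g := (ModuleCat.epi_iff_surjective _).2 hg }
  obtain ⟨t, ht⟩ := ENat.ne_top_iff_exists.1 h.ne_top
  have h1 : (t : ℕ∞) ≤ moduleDepth R W₁ := ht.le
  have h1' : ¬ ((t + 1 : ℕ) : ℕ∞) ≤ moduleDepth R W₁ := by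
    rw [← ht]
    exact_mod_cast Nat.not_succ_le_self t
  have h3 : ((t + 1 : ℕ) : ℕ∞) ≤ moduleDepth R W₃ := by
    rw [← ht] at h
    exact_mod_cast Order.add_one_le_of_lt h
  rw [← ht]
  have e1 := fun n => le_moduleDepth_iff (ModuleCat.of R W₁) n
  have e2 := fun n => le_moduleDepth_iff (ModuleCat.of R W₂) n
  have e3 := fun n => le_moduleDepth_iff (ModuleCat.of R W₃) n
  replace h1 := (e1 _).1 h1
  replace h3 := (e3 _).1 h3
  refine le_antisymm (le_of_not_gt fun hlt => h1' ((e1 _).2 fun i hi => ?_))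
    ((e2 _).2 fun i hi => ?_)
  -- If the depth of `W₂` exceeded `t`, then `Ext^{i+1}(k, W₁)`, between `Ext^i(k, W₃)` and
  -- `Ext^{i+1}(k, W₂)`, would vanish up to `t`; for `Ext^0`, `Hom(k, W₁)` embeds into `Hom(k, W₂)`.
  · have h2 := (e2 (t + 1)).1 (by exact_mod_cast Order.add_one_le_of_lt hlt) i hi
    rcases i with _ | i
    · have hs : Subsingleton (ModuleCat.of R (Shrink.{v} (R ⧸ maximalIdeal R)) ⟶
          ModuleCat.of R W₂) := Ext.addEquiv₀.subsingleton_congr.mp h2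
      refine Ext.addEquiv₀.subsingleton_congr.mpr ⟨fun a b => ?_⟩
      have := hS.mono_f
      exact (cancel_mono (ModuleCat.ofHom f)).1 (Subsingleton.elim _ _)
    · have z2 := AddCommGrpCat.isZero_of_iff_subsingleton.mpr h2
      have z3 := AddCommGrpCat.isZero_of_iff_subsingleton.mpr (h3 i (by omega))
      exact AddCommGrpCat.subsingleton_of_isZero <| ShortComplex.Exact.isZero_of_both_zeros
        (Ext.covariant_sequence_exact₁' _ hS i (i + 1) rfl)
        (z3.eq_zero_of_src _) (z2.eq_zero_of_tgt _)
  · have z1 := AddCommGrpCat.isZero_of_iff_subsingleton.mpr (h1 i hi)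
    have z3 := AddCommGrpCat.isZero_of_iff_subsingleton.mpr (h3 i (by omega))
    exact AddCommGrpCat.subsingleton_of_isZero <| ShortComplex.Exact.isZero_of_both_zeros
        (Ext.covariant_sequence_exact₂' _ hS i)
        (z1.eq_zero_of_src _) (z3.eq_zero_of_tgt _)

/-- Depth does not change under restriction of scalars along a surjective homomorphism. -/
theorem moduleDepth_congr {R A W V : Type*} [CommRing R] [IsLocalRing R] [CommRing A]
    [IsLocalRing A] [AddCommGroup W] [Module R W] [AddCommGroup V] [Module A V] (f : R →+* A)
    (hf : Function.Surjective f) (e : W ≃+ V) (he : ∀ r w, e (r • w) = f r • e w) :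
    moduleDepth R W = moduleDepth A V := by
  have hloc : IsLocalHom f := hf.isLocalHom
  have hmax : ∀ r, f r ∈ maximalIdeal A ↔ r ∈ maximalIdeal R := fun r => by
    rw [mem_maximalIdeal, mem_maximalIdeal, mem_nonunits_iff, mem_nonunits_iff, isUnit_map_iff]
  have hreg : ∀ rs : List R, IsRegular W rs ↔ IsRegular V (rs.map f) := fun rs =>
    AddEquiv.isRegular_congr (e := e) (List.forall₂_map_right_iff.2
      (List.forall₂_same.2 fun r _ w => he r w))
  refine le_antisymm (iSup₂_le fun rs hrs => ?_) (iSup₂_le fun rs hrs => ?_)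
  · refine le_iSup₂_of_le (rs.map f) ⟨?_, (hreg rs).1 hrs.2⟩ (by simp)
    simpa [hmax] using hrs.1
  · obtain ⟨rs, rfl⟩ := List.map_surjective_iff.2 hf rs
    refine le_iSup₂_of_le rs ⟨?_, (hreg rs).2 hrs.2⟩ (by simp)
    simpa [hmax] using hrs.1

/-- Each member of a regular sequence lowers the dimension by exactly one, and the final quotient is
nonzero, so its dimension is not negative. -/
theorem moduleDepth_le_supportDim {R W : Type*} [CommRing R] [IsLocalRing R] [IsNoetherianRing R]
    [AddCommGroup W] [Module R W] [Module.Finite R W] [Nontrivial W] :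
    ((moduleDepth R W : ℕ∞) : WithBot ℕ∞) ≤ Module.supportDim R W := by
  obtain ⟨D, hD⟩ := WithBot.ne_bot_iff_exists.1 (Module.supportDim_ne_bot_of_nontrivial R W)
  rw [← hD]
  refine WithBot.coe_le_coe.2 (iSup₂_le fun rs hrs => WithBot.coe_le_coe.1 ?_)
  rw [hD, ← Module.supportDim_add_length_eq_supportDim_of_isRegular rs hrs.2]
  have : Nontrivial (W ⧸ Ideal.ofList rs • (⊤ : Submodule R W)) :=
    Submodule.Quotient.nontrivial_iff.2 hrs.2.top_ne_smul.symm
  have h0 : 0 ≤ Module.supportDim R (W ⧸ Ideal.ofList rs • (⊤ : Submodule R W)) :=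
    Order.krullDim_nonneg_iff.2 (Module.nonempty_support_of_nontrivial).to_subtype
  simpa using add_le_add_left h0 (rs.length : WithBot ℕ∞)

end Depth

theorem IsRegularLocalRing.moduleDepth_eq {A : Type*} [CommRing A] [IsRegularLocalRing A] {d : ℕ}
    (hd : ringKrullDim A = d) : moduleDepth A A = d := by
  apply le_antisymm
  · have h := moduleDepth_le_supportDim (R := A) (W := A)
    rw [Module.supportDim_self_eq_ringKrullDim, hd] at h
    exact_mod_cast h
  · obtain ⟨x, hx⟩ : ∃ x : Fin d → A, Ideal.span (Set.range x) = IsLocalRing.maximalIdeal A := by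
      have hfg : Submodule.FG (IsLocalRing.maximalIdeal A) := IsNoetherian.noetherian _
      have hc := hfg.generators_ncard
      rw [spanFinrank_maximalIdeal_eq hd] at hc
      have : Finite (Submodule.generators (IsLocalRing.maximalIdeal A)) := hfg.finite_generators
      let e := Finite.equivFinOfCardEq hc
      refine ⟨fun i => (e.symm i : A), ?_⟩
      rw [← Function.comp_def, e.symm.surjective.range_comp, Subtype.range_coe]
      exact Submodule.span_generators _
    have hreg := IsRegularLocalRing.isWeaklyRegular_ofFn hd hx
    have hmem : ∀ r ∈ List.ofFn x, r ∈ IsLocalRing.maximalIdeal A := by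
      intro r hr
      obtain ⟨i, rfl⟩ := (List.mem_ofFn' _ _).1 hr
      exact hx ▸ Ideal.subset_span ⟨i, rfl⟩
    exact le_iSup₂_of_le (List.ofFn x)
      ⟨hmem, RingTheory.Sequence.IsRegular.of_isWeaklyRegular_of_mem_maximalIdeal A hmem hreg⟩
      (by simp)

/-! ### Idealizations -/

namespace TrivSqZeroExt

variable {A M : Type*} [CommRing A] [AddCommGroup M] [Module A M] [Module Aᵐᵒᵖ M]
  [IsCentralScalar A M]

instance isNoetherianRing_of_finite [IsNoetherianRing A] [Module.Finite A M] :
    IsNoetherianRing (TrivSqZeroExt A M) := by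
  have : Module.Finite A (TrivSqZeroExt A M) := inferInstanceAs (Module.Finite A (A × M))
  exact isNoetherianRing_iff.2 (isNoetherian_of_tower A inferInstance)

instance isLocalRing [IsLocalRing A] : IsLocalRing (TrivSqZeroExt A M) :=
  have : Nontrivial (TrivSqZeroExt A M) := inferInstanceAs (Nontrivial (A × M))
  .of_isUnit_or_isUnit_one_sub_self fun a => by
    rw [isUnit_iff_isUnit_fst, isUnit_iff_isUnit_fst, fst_sub, fst_one]
    exact IsLocalRing.isUnit_or_isUnit_one_sub_self _

theorem mem_maximalIdeal_iff [IsLocalRing A] {z : TrivSqZeroExt A M} :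
    z ∈ IsLocalRing.maximalIdeal (TrivSqZeroExt A M) ↔ z.fst ∈ IsLocalRing.maximalIdeal A := by
  rw [IsLocalRing.mem_maximalIdeal, IsLocalRing.mem_maximalIdeal, mem_nonunits_iff,
    mem_nonunits_iff, isUnit_iff_isUnit_fst]

variable (A M) in
/-- The first projection as a ring homomorphism. -/
def fstRingHom : TrivSqZeroExt A M →+* A := (fstHom A A M).toRingHom

theorem fstRingHom_surjective : Function.Surjective (fstRingHom A M) := fun a => ⟨inl a, rfl⟩

/-- Every prime contains the square-zero elements `inr u`, so it is determined by its contraction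
along `inl`. -/
theorem ringKrullDim_eq : ringKrullDim (TrivSqZeroExt A M) = ringKrullDim A := by
  refine le_antisymm ?_ (ringKrullDim_le_of_surjective _ (fstRingHom_surjective (M := M)))
  rw [ringKrullDim, ringKrullDim]
  refine Order.krullDim_le_of_strictMono
    (fun p => PrimeSpectrum.comap (inlHom A M) p) fun p q hpq => ?_
  have key : ∀ (p : PrimeSpectrum (TrivSqZeroExt A M)) z,
      inl z.fst ∈ p.asIdeal ↔ z ∈ p.asIdeal := by
    intro p z
    have h : inr z.snd ∈ p.asIdeal := by
      refine p.isPrime.mem_of_pow_mem 2 ?_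
      rw [pow_two, inr_mul_inr]
      exact zero_mem _
    conv_rhs => rw [← inl_fst_add_inr_snd_eq z]
    exact (p.asIdeal.add_mem_iff_left h).symm
  refine lt_of_le_of_ne (fun a ha => hpq.le ha) fun h => hpq.ne ?_
  ext z
  rw [← key p, ← key q]
  exact Ideal.ext_iff.1 (congrArg PrimeSpectrum.asIdeal h) z.fst

/-- Apply the depth lemma to `0 → M → A ⋉ M → A → 0`; the depths of both ends may be computed over
`A`, since `A ⋉ M` acts on them through the projection. -/
theorem moduleDepth_eq [IsLocalRing A] [IsNoetherianRing A] [Module.Finite A M] [Nontrivial M]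
    (h : moduleDepth A M < moduleDepth A A) :
    moduleDepth (TrivSqZeroExt A M) (TrivSqZeroExt A M) = moduleDepth A M := by
  let N := RingHom.ker (fstRingHom A M)
  let eM : N ≃+ M :=
    { toFun := fun z => z.1.snd
      invFun := fun u => ⟨inr u, rfl⟩
      left_inv := fun z => Subtype.ext (TrivSqZeroExt.ext (Eq.symm z.2) rfl)
      right_inv := fun u => rfl
      map_add' := fun _ _ => rfl }
  let eA : (TrivSqZeroExt A M ⧸ N) ≃+ A :=
    (RingHom.quotientKerEquivOfSurjective (fstRingHom_surjective (M := M))).toAddEquiv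
  have hM : moduleDepth (TrivSqZeroExt A M) N = moduleDepth A M := by
    refine moduleDepth_congr (fstRingHom A M) fstRingHom_surjective eM fun r z => ?_
    have hz : z.1.fst = 0 := z.2
    change (r * z.1).snd = r.fst • z.1.snd
    simp [hz]
  have hA : moduleDepth (TrivSqZeroExt A M) (TrivSqZeroExt A M ⧸ N) = moduleDepth A A := by
    refine moduleDepth_congr (fstRingHom A M) fstRingHom_surjective eA fun r z => ?_
    obtain ⟨z, rfl⟩ := Ideal.Quotient.mk_surjective z
    rfl
  have : Nontrivial N := eM.toEquiv.nontrivial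
  have : Nontrivial (TrivSqZeroExt A M ⧸ N) := eA.toEquiv.nontrivial
  rw [← hM]
  exact moduleDepth_eq_of_exact (W₁ := N) (W₃ := TrivSqZeroExt A M ⧸ N) (Submodule.subtype N)
    (Submodule.mkQ N) Subtype.val_injective
    (Submodule.mkQ_surjective N) (LinearMap.exact_subtype_mkQ N) (by rwa [hM, hA])

end TrivSqZeroExt

/-! ### The associated graded ring of a local ring -/

namespace MvPolynomial

variable {σ k K : Type*} [CommRing k] [CommRing K]

theorem map_degreeProj (f : k →+* K) (n : ℤ) (p : MvPolynomial σ k) :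
    map f (degreeProj n p) = degreeProj n (map f p) := by
  ext m
  rw [coeff_map, coeff_degreeProj, coeff_degreeProj, coeff_map]
  split_ifs
  · rfl
  · exact map_zero f

theorem isHomogeneous_iff_degreeProj {n : ℕ} {p : MvPolynomial σ k} :
    p.IsHomogeneous n ↔ degreeProj n p = p := by
  constructor
  · intro h
    ext m
    rw [coeff_degreeProj]
    split_ifs with hm
    · rfl
    · by_contra h0
      exact hm (by exact_mod_cast h.degree_eq (Ne.symm h0))
  · intro h
    refine isHomogeneous_of_degree fun m hm => ?_
    rw [← h, coeff_degreeProj] at hm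
    by_contra h0
    exact hm (if_neg (by exact_mod_cast h0))

end MvPolynomial

namespace AssocGraded

open IsLocalRing

section

variable {R : Type*} [CommRing R] {I : Ideal R}

theorem exists_sum_degreeProj (z : Gr I) :
    ∃ N, ∀ N' ≥ N, z = ∑ n ∈ Finset.range N', degreeProj I n z := by
  induction z using AssocGraded.induction_on with
  | form m a ha =>
    refine ⟨m + 1, fun N' hN => ?_⟩
    rw [Finset.sum_eq_single m]
    · rw [degreeProj_form, if_pos rfl]
    · intro n _ hn
      rw [degreeProj_form, if_neg (by exact_mod_cast hn.symm)]
    · exact fun h => absurd (Finset.mem_range.2 hN) h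
  | add z w hz hw =>
    obtain ⟨N, hN⟩ := hz
    obtain ⟨N', hN'⟩ := hw
    refine ⟨max N N', fun n hn => ?_⟩
    simp only [map_add, Finset.sum_add_distrib]
    rw [← hN n (le_of_max_le_left hn), ← hN' n (le_of_max_le_right hn)]

/-- An additive subgroup which contains the components of an element contains the element. -/
theorem mem_of_degreeProj_mem (H : AddSubgroup (Gr I)) {z : Gr I}
    (h : ∀ n : ℕ, degreeProj I n z ∈ H) : z ∈ H := by
  obtain ⟨N, hN⟩ := exists_sum_degreeProj z
  rw [hN N le_rfl]
  exact sum_mem fun n _ => h n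

theorem form_mem_irrelevantIdeal {n : ℕ} (hn : 0 < n) {a : R} (ha : a ∈ I ^ n) :
    form I n a ha ∈ Cech.irrelevantIdeal (grComponent I) :=
  Ideal.subset_span ⟨n, hn, mem_component_iff.2 ⟨a, ha, rfl⟩⟩

theorem degreeProj_zero_of_mem_irrelevantIdeal {z : Gr I}
    (hz : z ∈ Cech.irrelevantIdeal (grComponent I)) : degreeProj I 0 z = 0 := by
  induction hz using Submodule.span_induction with
  | mem z h =>
    obtain ⟨n, hn, h⟩ := h
    obtain ⟨a, ha, rfl⟩ := mem_component_iff.1 h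
    rw [degreeProj_form, if_neg (by omega)]
  | zero => exact map_zero _
  | add z w _ _ hz hw => rw [map_add, hz, hw, add_zero]
  | smul c z _ hz =>
    refine AssocGraded.induction_on c (fun n a ha => ?_) (fun c c' hc hc' => ?_)
    · rcases n with _ | n
      · have := degreeProj_mul (mem_component_iff.2 ⟨a, ha, rfl⟩) 0 z
        rwa [hz, mul_zero, Nat.cast_zero, add_zero] at this
      · have := degreeProj_mul (mem_component_iff.2 ⟨a, ha, rfl⟩) (-(n + 1 : ℕ)) z
        rwa [neg_add_cancel, degreeProj_of_neg (n := -(n + 1 : ℕ)) (by omega), mul_zero] at this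
    · rw [add_smul, map_add, hc, hc', add_zero]

/-- The ideal `G₊` is generated by the forms of degree `1` of generators of `I`. -/
theorem span_range_form {ι : Type*} {g : ι → R} (hg : ∀ i, g i ∈ I ^ 1)
    (hI : Ideal.span (Set.range g) = I) :
    Ideal.span (Set.range fun i => form I 1 (g i) (hg i)) =
      Cech.irrelevantIdeal (grComponent I) := by
  apply le_antisymm
  · rw [Ideal.span_le]
    rintro _ ⟨i, rfl⟩
    exact form_mem_irrelevantIdeal one_pos _
  · set J := Ideal.span (Set.range fun i => form I 1 (g i) (hg i)) with hJ
    have h1 : ∀ b (hb : b ∈ I ^ 1), form I 1 b hb ∈ J := by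
      intro b hb
      have hb' := hb
      rw [pow_one, ← hI] at hb'
      have hI' : ∀ {c}, c ∈ Submodule.span R (Set.range g) → c ∈ I ^ 1 := fun h => by
        rw [pow_one, ← hI]; exact h
      induction hb' using Submodule.span_induction with
      | mem b h =>
        obtain ⟨i, rfl⟩ := h
        exact Ideal.subset_span ⟨i, rfl⟩
      | zero => rw [form_zero]; exact zero_mem _
      | add b c hb' hc' hb'' hc'' =>
        have h1 := add_mem (hb'' (hI' hb')) (hc'' (hI' hc'))
        rwa [form_add] at h1
      | smul r b hb' hb'' =>
        have h1 := J.mul_mem_left (baseMap I r) (hb'' (hI' hb'))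
        rw [baseMap_apply, form_mul] at h1
        convert h1 using 1
        exact form_congr (by rw [zero_add]) rfl _ _
    refine Ideal.span_le.2 ?_
    rintro z ⟨n, hn, hz⟩
    obtain ⟨a, ha, rfl⟩ := mem_component_iff.1 hz
    obtain ⟨n, rfl⟩ := Nat.exists_eq_succ_of_ne_zero hn.ne'
    change form I (n + 1) a ha ∈ J
    have ha' := ha
    rw [pow_succ] at ha'
    induction ha' using Submodule.mul_induction_on' with
    | mem_mul_mem a ha' b hb =>
      have h := J.mul_mem_left (form I n a ha') (h1 b (by rwa [pow_one]))
      rwa [form_mul] at h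
    | add a ha' b hb' ha'' hb'' =>
      have hA : a ∈ I ^ (n + 1) := by rwa [pow_succ]
      have hB : b ∈ I ^ (n + 1) := by rwa [pow_succ]
      have h := add_mem (ha'' hA (mem_component_iff.2 ⟨_, _, rfl⟩))
        (hb'' hB (mem_component_iff.2 ⟨_, _, rfl⟩))
      rwa [form_add] at h

end

section Local

variable {A : Type*} [CommRing A]

/-- The associated graded ring of a regular local ring is a polynomial ring over the residue
field. -/
theorem exists_ringHom_mvPolynomial [IsRegularLocalRing A] {d : ℕ} (hd : ringKrullDim A = d)
    {g : Fin d → A} (hg : Ideal.span (Set.range g) = maximalIdeal A)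
    (hg' : ∀ i, g i ∈ maximalIdeal A) :
    ∃ φ : Gr (maximalIdeal A) →+* MvPolynomial (Fin d) (ResidueField A),
      Function.Injective φ ∧ ∀ F, φ (polyMap hg' F) = MvPolynomial.map (residue A) F := by
  have hsurj := polyMap_surjective hg' hg
  -- The kernel of `A[X] → G(A)` consists of the polynomials with coefficients in `m`:
  -- quasi-regularity applied to each homogeneous component.
  have key : ∀ F, polyMap hg' F = 0 ↔ MvPolynomial.map (residue A) F = 0 := by
    intro F
    constructor
    · intro hF
      ext m
      rw [MvPolynomial.coeff_map, MvPolynomial.coeff_zero, residue_eq_zero_iff, ← hg]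
      have hom : (MvPolynomial.degreeProj m.degree F).IsHomogeneous m.degree :=
        MvPolynomial.isHomogeneous_iff_degreeProj.2 (MvPolynomial.degreeProj_idem _ _)
      have h0 : polyMap hg' (MvPolynomial.degreeProj m.degree F) = 0 := by
        rw [polyMap_degreeProj, hF, map_zero]
      rw [polyMap_of_isHomogeneous hg' hom, form_eq_zero, ← hg] at h0
      have := MvPolynomial.coeff_mem_of_eval_mem_pow_succ g
        (IsRegularLocalRing.regularModTail hd hg) _ _ hom h0 m
      rwa [MvPolynomial.coeff_degreeProj, if_pos rfl] at this
    · intro hF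
      rw [MvPolynomial.as_sum F, map_sum]
      refine Finset.sum_eq_zero fun m _ => ?_
      have hc : MvPolynomial.coeff m F ∈ maximalIdeal A := by
        rw [← residue_eq_zero_iff, ← MvPolynomial.coeff_map, hF, MvPolynomial.coeff_zero]
      rw [polyMap_monomial, form_eq_zero, pow_succ']
      refine Ideal.mul_mem_mul hc ?_
      simpa using prod_mem_pow_degree hg' m 1
  let φ : Gr (maximalIdeal A) →+* MvPolynomial (Fin d) (ResidueField A) :=
    RingHom.liftOfSurjective (polyMap hg') hsurj
      ⟨MvPolynomial.map (residue A), fun F hF => (key F).1 hF⟩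
  have hφ : ∀ F, φ (polyMap hg' F) = MvPolynomial.map (residue A) F := fun F =>
    RingHom.liftOfRightInverse_comp_apply _ _ _ _ _
  refine ⟨φ, (injective_iff_map_eq_zero φ).2 fun z hz => ?_, hφ⟩
  obtain ⟨F, rfl⟩ := hsurj z
  rw [hφ] at hz
  exact (key F).2 hz

/-- A homogeneous system of generators of `G₊` contains the initial forms of a minimal system of
generators of the maximal ideal. -/
theorem exists_forms_of_generators [IsLocalRing A] [IsNoetherianRing A] {d s : ℕ}
    (hd : Module.finrank (ResidueField A) (CotangentSpace A) = d)
    (y : Fin s → Gr (maximalIdeal A)) (e : Fin s → ℕ)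
    (hy : ∀ j, y j ∈ grComponent (maximalIdeal A) (e j))
    (hspan : Ideal.span (Set.range y) = Cech.irrelevantIdeal (grComponent (maximalIdeal A))) :
    ∃ (g : Fin d → A) (c : Fin d → Fin s) (hg : ∀ i, g i ∈ maximalIdeal A ^ 1),
      Ideal.span (Set.range g) = maximalIdeal A ∧
      ∀ i, e (c i) = 1 ∧ y (c i) = form (maximalIdeal A) 1 (g i) (hg i) := by
  have hm1 : ∀ {a : A}, a ∈ maximalIdeal A ^ 1 ↔ a ∈ maximalIdeal A := by simp
  choose a ha hya using fun j => mem_component_iff.1 (hy j)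
  let T := {j : Fin s // e j = 1}
  have hT : ∀ j : T, a j ∈ maximalIdeal A := fun j => by
    have := ha j
    rwa [j.2, pow_one] at this
  have hyT : ∀ j : T, y j = form (maximalIdeal A) 1 (a j) (hm1.2 (hT j)) := fun j =>
    (hya j).trans (form_congr j.2 rfl _ _)
  let L := Ideal.span (Set.range fun j : T => a j) ⊔ maximalIdeal A ^ 2
  -- Modulo `m ^ 2`, only the generators of degree one, with coefficients of degree zero, contribute
  -- to the component of degree one; a generator of assigned degree zero lies in `G₊`, hence is
  -- zero.
  have hQ : ∀ z ∈ Ideal.span (Set.range y), ∃ r hr,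
      degreeProj (maximalIdeal A) 1 z = form (maximalIdeal A) 1 r hr ∧ r ∈ L := by
    intro z hz
    have h0 : ∀ z, degreeProj (maximalIdeal A) 1 z = 0 → ∃ r hr,
        degreeProj (maximalIdeal A) 1 z = form (maximalIdeal A) 1 r hr ∧ r ∈ L := fun z hz =>
      ⟨0, zero_mem _, by rw [hz, form_zero], zero_mem _⟩
    have hadd : ∀ z w, (∃ r hr,
        degreeProj (maximalIdeal A) 1 z = form (maximalIdeal A) 1 r hr ∧ r ∈ L) → (∃ r hr,
        degreeProj (maximalIdeal A) 1 w = form (maximalIdeal A) 1 r hr ∧ r ∈ L) → ∃ r hr,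
        degreeProj (maximalIdeal A) 1 (z + w) = form (maximalIdeal A) 1 r hr ∧ r ∈ L := by
      rintro z w ⟨r, hr, hzr, hrL⟩ ⟨r', hr', hwr, hrL'⟩
      exact ⟨r + r', add_mem hr hr', by rw [map_add, hzr, hwr, form_add], add_mem hrL hrL'⟩
    obtain ⟨b, rfl⟩ := (Ideal.mem_span_range_iff_exists_fun).1 hz
    refine Finset.sum_induction _ _ hadd (h0 _ (map_zero _)) fun j _ => ?_
    refine AssocGraded.induction_on (b j) (fun n c hc => ?_)
      (fun c c' hc hc' => by rw [add_mul]; exact hadd _ _ hc hc')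
    by_cases hj0 : e j = 0
    · have : degreeProj (maximalIdeal A) 0 (y j) = 0 :=
        degreeProj_zero_of_mem_irrelevantIdeal (hspan ▸ Ideal.subset_span ⟨j, rfl⟩)
      have hyj := mem_component_iff_degreeProj.1 (hy j)
      rw [hj0, Nat.cast_zero, this] at hyj
      exact h0 _ (by rw [← hyj, mul_zero, map_zero])
    by_cases hj1 : e j = 1 ∧ n = 0
    · obtain ⟨hj1, rfl⟩ := hj1
      have haj := hT ⟨j, hj1⟩
      refine ⟨c * a j, hm1.2 (Ideal.mul_mem_left _ _ haj), ?_,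
        Ideal.mul_mem_left _ _ (Ideal.mem_sup_left (Ideal.subset_span ⟨⟨j, hj1⟩, rfl⟩))⟩
      rw [hyT ⟨j, hj1⟩, form_mul, degreeProj_form, if_pos (by simp)]
    · refine h0 _ ?_
      rw [hya j, form_mul, degreeProj_form, if_neg (by omega)]
  have hL : maximalIdeal A ≤ L := by
    intro b hb
    obtain ⟨r, hr, hbr, hrL⟩ := hQ (form (maximalIdeal A) 1 b (hm1.2 hb))
      (hspan ▸ form_mem_irrelevantIdeal one_pos _)
    rw [degreeProj_form, if_pos (by simp)] at hbr
    have h1 : form (maximalIdeal A) 1 (b - r) (sub_mem (hm1.2 hb) hr) = 0 := by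
      have h2 := form_add (sub_mem (hm1.2 hb) hr) hr
      rw [form_congr rfl (sub_add_cancel b r) _ (hm1.2 hb), hbr] at h2
      exact add_eq_right.1 h2
    rw [form_eq_zero] at h1
    rw [← sub_add_cancel b r]
    exact add_mem (Ideal.mem_sup_right h1) hrL
  have hspanT : Ideal.span (Set.range fun j : T => a j) = maximalIdeal A := by
    refine le_antisymm (Ideal.span_le.2 ?_) ?_
    · rintro _ ⟨j, rfl⟩
      exact hT j
    · refine Submodule.le_of_le_smul_of_le_jacobson_bot (IsNoetherian.noetherian (maximalIdeal A))
        (IsLocalRing.maximalIdeal_le_jacobson ⊥) ?_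
      rwa [smul_eq_mul, ← pow_two]
  have hcot : ∀ {κ : Type} (u : κ → T),
      Submodule.span (ResidueField A)
        (Set.range fun i => (maximalIdeal A).toCotangent ⟨a (u i), hT (u i)⟩) = ⊤ ↔
      Ideal.span (Set.range fun i => a (u i)) = maximalIdeal A := by
    intro κ u
    have h1 : (Set.range fun i => (maximalIdeal A).toCotangent ⟨a (u i), hT (u i)⟩) =
        (maximalIdeal A).toCotangent '' Set.range fun i => ⟨a (u i), hT (u i)⟩ :=
      Set.range_comp (maximalIdeal A).toCotangent _
    have h2 : (Set.range fun i => a (u i)) =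
        (maximalIdeal A).subtype '' Set.range fun i =>
          (⟨a (u i), hT (u i)⟩ : maximalIdeal A) := by
      rw [← Set.range_comp]; rfl
    have h3 : Submodule.map (maximalIdeal A).subtype ⊤ = maximalIdeal A := by simp
    refine (iff_of_eq (congrArg (fun S => Submodule.span (ResidueField A) S = ⊤) h1)).trans ?_
    rw [CotangentSpace.span_image_eq_top_iff, h2, Ideal.span, Submodule.span_image]
    conv_rhs => rhs; rw [← h3]
    exact (Submodule.map_injective_of_injective (Submodule.subtype_injective _)).eq_iff.symm
  -- By Nakayama the degree-one generators lift to generators of `m`; their classes are thinned out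
  -- to a basis of the cotangent space.
  obtain ⟨κ, u, -, hu, hli⟩ := exists_linearIndependent' (ResidueField A)
    fun j : T => ((maximalIdeal A).toCotangent ⟨a j, hT j⟩ : CotangentSpace A)
  have htop := (hcot (id : T → T)).2 hspanT
  have htop' := hu.trans htop
  let B := Module.Basis.mk hli htop'.ge
  have hcard : Nat.card κ = d := by rw [← hd, Module.finrank_eq_nat_card_basis B]
  have : Finite κ := Module.Finite.finite_basis B
  let ε := Finite.equivFinOfCardEq hcard
  refine ⟨fun i => a (u (ε.symm i)), fun i => u (ε.symm i), fun i => hm1.2 (hT _), ?_,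
    fun i => ⟨(u (ε.symm i)).2, hyT _⟩⟩
  have h1 := (hcot u).1 htop'
  rw [← h1]
  congr 1
  exact ε.symm.surjective.range_comp fun i => a (u i)

end Local

end AssocGraded

/-! ### The associated graded ring of an idealization -/

open IsLocalRing in
/-- A module of small dimension is annihilated by an element which has an initial form. -/
theorem IsRegularLocalRing.exists_mem_annihilator {A M : Type*} [CommRing A]
    [IsRegularLocalRing A] [AddCommGroup M] [Module A M] [Module.Finite A M] {d : ℕ}
    (hA : ringKrullDim A = d) (hM : Module.supportDim A M < d) :
    ∃ (n : ℕ) (a : A), a ∈ Module.annihilator A M ∧ a ∈ maximalIdeal A ^ n ∧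
      a ∉ maximalIdeal A ^ (n + 1) := by
  have hne : Module.annihilator A M ≠ ⊥ := by
    intro h
    rw [Module.supportDim_eq_ringKrullDim_quotient_annihilator, h,
      ringKrullDim_eq_of_ringEquiv (RingEquiv.quotientBot A), hA] at hM
    exact lt_irrefl _ hM
  obtain ⟨a, ha, ha0⟩ := Submodule.exists_mem_ne_zero_of_ne_bot hne
  -- Krull's intersection theorem; the `n` returned is the order of `a`, one less than the first
  -- power that misses it.
  have hex : ∃ n, a ∉ maximalIdeal A ^ n := by
    by_contra! h
    have h1 : a ∈ ⨅ i, maximalIdeal A ^ i := (Submodule.mem_iInf _).2 h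
    rw [Ideal.iInf_pow_eq_bot_of_isLocalRing _ (maximalIdeal.isMaximal A).ne_top] at h1
    exact ha0 h1
  classical
  obtain ⟨n, hn⟩ : ∃ n, Nat.find hex = n + 1 := by
    refine Nat.exists_eq_succ_of_ne_zero fun h => ?_
    have := Nat.find_spec hex
    rw [h] at this
    exact this (by simp)
  refine ⟨n, a, ha, ?_, hn ▸ Nat.find_spec hex⟩
  by_contra h
  exact Nat.find_min hex (by omega) h

namespace TrivSqZeroExt

open IsLocalRing AssocGraded

variable {A M : Type*} [CommRing A] [AddCommGroup M] [Module A M] [Module Aᵐᵒᵖ M]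
  [IsCentralScalar A M]

section Local

variable [IsLocalRing A]

theorem map_fstRingHom_maximalIdeal_le :
    (maximalIdeal (TrivSqZeroExt A M)).map (fstRingHom A M) ≤ maximalIdeal A :=
  Ideal.map_le_iff_le_comap.2 fun _ hz => mem_maximalIdeal_iff.1 hz

theorem inl_mem_maximalIdeal_pow {n : ℕ} {a : A} (ha : a ∈ maximalIdeal A ^ n) :
    (inl a : TrivSqZeroExt A M) ∈ maximalIdeal (TrivSqZeroExt A M) ^ n :=
  map_mem_pow (inlHom A M) (Ideal.map_le_iff_le_comap.2 fun _ hz => mem_maximalIdeal_iff.2 hz) ha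

variable (A M) in
/-- The homomorphism of associated graded rings induced by the first projection. -/
noncomputable def gradedFst :
    Gr (maximalIdeal (TrivSqZeroExt A M)) →+* Gr (maximalIdeal A) :=
  gradedMap (fstRingHom A M) map_fstRingHom_maximalIdeal_le

theorem fst_mem_maximalIdeal_pow {n : ℕ} {z : TrivSqZeroExt A M} (hz : z ∈ maximalIdeal _ ^ n) :
    z.fst ∈ maximalIdeal A ^ n :=
  map_mem_pow (fstRingHom A M) map_fstRingHom_maximalIdeal_le hz

theorem gradedFst_form {n : ℕ} {z : TrivSqZeroExt A M} (hz : z ∈ maximalIdeal _ ^ n) :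
    gradedFst A M (form _ n z hz) = form _ n z.fst (fst_mem_maximalIdeal_pow hz) :=
  gradedMap_form _ _ n z hz

theorem gradedFst_form_inl {n : ℕ} {a : A} (ha : a ∈ maximalIdeal A ^ n) :
    gradedFst A M (form _ n (inl a) (inl_mem_maximalIdeal_pow ha)) = form _ n a ha :=
  gradedFst_form _

theorem gradedFst_surjective : Function.Surjective (gradedFst A M) := by
  intro z
  induction z using AssocGraded.induction_on with
  | form n a ha => exact ⟨_, gradedFst_form_inl ha⟩
  | add z w hz hw =>
    obtain ⟨z, rfl⟩ := hz
    obtain ⟨w, rfl⟩ := hw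
    exact ⟨z + w, map_add _ _ _⟩

theorem gradedFst_degreeProj (n : ℤ) (z) :
    gradedFst A M (degreeProj _ n z) = degreeProj _ n (gradedFst A M z) :=
  gradedMap_degreeProj _ _ n z

/-- The kernel of the graded projection is generated by the forms of elements of `M`. -/
theorem mem_closure_of_mem_ker_gradedFst {z} (hz : z ∈ RingHom.ker (gradedFst A M)) :
    z ∈ AddSubgroup.closure
      {w : Gr (maximalIdeal (TrivSqZeroExt A M)) | ∃ n u hu, w = form _ n (inr u) hu} := by
  refine mem_of_degreeProj_mem _ fun n => ?_
  obtain ⟨r, hr, h⟩ := mem_component_iff.1 (degreeProj_mem_component n z)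
  have h0 : gradedFst A M (form _ n r hr) = 0 := by
    rw [← h, gradedFst_degreeProj, RingHom.mem_ker.1 hz, map_zero]
  rw [gradedFst_form, form_eq_zero] at h0
  have h1 := inl_mem_maximalIdeal_pow (M := M) h0
  have h2 := Ideal.pow_le_pow_right n.le_succ h1
  -- A representative `(b, u)` of a form of degree `n` in the kernel has `b ∈ m ^ (n + 1)`. Removing
  -- `(b, 0)` changes neither membership in the `n`-th power nor the form.
  have h3 : inr r.snd ∈ maximalIdeal (TrivSqZeroExt A M) ^ n := by
    have := sub_mem hr h2
    rwa [← inl_fst_add_inr_snd_eq r, fst_add, fst_inl, fst_inr, add_zero,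
      add_sub_cancel_left] at this
  refine AddSubgroup.subset_closure ⟨n, r.snd, h3, ?_⟩
  rw [h, form_congr rfl (inl_fst_add_inr_snd_eq r).symm hr (add_mem h2 h3), ← form_add h2 h3,
    (form_eq_zero h2).2 h1, zero_add]

theorem mul_eq_zero_of_mem_ker_gradedFst {y z} (hz : z ∈ RingHom.ker (gradedFst A M))
    (hy : ∀ (n : ℕ) (u : M) hu, y * form (maximalIdeal (TrivSqZeroExt A M)) n (inr u) hu = 0) :
    y * z = 0 := by
  have h := mem_closure_of_mem_ker_gradedFst hz
  revert h
  suffices AddSubgroup.closure _ ≤ (AddMonoidHom.mulLeft y).ker from fun h => this h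
  rw [AddSubgroup.closure_le]
  rintro _ ⟨n, u, hu, rfl⟩
  exact hy n u hu

end Local

/-- The kernel of the graded projection has small dimension. -/
theorem supportDim_ker_gradedFst_lt [IsRegularLocalRing A] [Module.Finite A M] {d : ℕ}
    (hA : ringKrullDim A = d) (hM : Module.supportDim A M < d)
    (φ : Gr (maximalIdeal A) →+* MvPolynomial (Fin d) (ResidueField A))
    (hφ : Function.Bijective φ) :
    Module.supportDim (Gr (maximalIdeal (TrivSqZeroExt A M))) (RingHom.ker (gradedFst A M)) <
      d := by
  set N := RingHom.ker (gradedFst A M) with hN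
  have hkill : ∀ y, (∀ z ∈ N, y * z = 0) → y ∈ Module.annihilator _ N := fun y hy =>
    Module.mem_annihilator.2 fun z => Subtype.ext (hy z z.2)
  have hNN : N ≤ Module.annihilator _ N := fun y hy => hkill y fun z hz => by
    refine mul_eq_zero_of_mem_ker_gradedFst hz fun n u hu => ?_
    rw [mul_comm]
    refine mul_eq_zero_of_mem_ker_gradedFst hy fun m v hv => ?_
    rw [form_mul, form_congr rfl (inr_mul_inr A u v) _ (zero_mem _), form_zero]
  obtain ⟨n, a, haM, han, han'⟩ := IsRegularLocalRing.exists_mem_annihilator hA hM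
  have hα : form _ n (inl a) (inl_mem_maximalIdeal_pow (M := M) han) ∈ Module.annihilator _ N :=
    hkill _ fun z hz => mul_eq_zero_of_mem_ker_gradedFst hz fun m u hu => by
      have h0 : (inl a * inr u : TrivSqZeroExt A M) = 0 := by
        rw [inl_mul_inr, Module.mem_annihilator.1 haM, inr_zero]
      rw [form_mul, form_congr rfl h0 _ (zero_mem _), form_zero]
  let ψ := φ.comp (gradedFst A M)
  have hψ : Function.Surjective ψ := hφ.2.comp gradedFst_surjective
  -- Because `N` annihilates itself, the quotient by its annihilator is a quotient of the polynomial
  -- ring.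
  have hker : RingHom.ker ψ ≤ RingHom.ker (Ideal.Quotient.mk (Module.annihilator _ N)) := by
    intro z hz
    rw [Ideal.mk_ker]
    exact hNN (hφ.1 (by simpa [ψ] using hz))
  let θ := RingHom.liftOfSurjective ψ hψ ⟨_, hker⟩
  have hθ : ∀ z, θ (ψ z) = Ideal.Quotient.mk _ z := fun z =>
    RingHom.liftOfRightInverse_comp_apply _ _ _ _ _
  have hθs : Function.Surjective θ := fun z => by
    obtain ⟨z, rfl⟩ := Ideal.Quotient.mk_surjective z
    exact ⟨_, hθ z⟩
  have hne : ψ (form _ n (inl a) (inl_mem_maximalIdeal_pow (M := M) han)) ≠ 0 := by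
    change φ _ ≠ 0
    rw [gradedFst_form_inl han, map_ne_zero_iff _ hφ.1, Ne, form_eq_zero]
    exact han'
  -- `θ` kills the image of the initial form of `a`, a nonzero element of a domain, so the dimension
  -- drops by at least one.
  have h := ringKrullDim_succ_le_of_surjective θ hθs (mem_nonZeroDivisors_of_ne_zero hne)
    ((hθ _).trans (Ideal.Quotient.eq_zero_iff_mem.2 hα))
  rw [MvPolynomial.ringKrullDim_of_isNoetherianRing, ringKrullDim_eq_zero_of_field, zero_add,
    Nat.card_fin, ← Module.supportDim_eq_ringKrullDim_quotient_annihilator] at h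
  generalize Module.supportDim (Gr (maximalIdeal (TrivSqZeroExt A M))) N = D at h ⊢
  induction D with
  | bot => exact WithBot.bot_lt_coe _
  | coe D =>
    have h' : D + 1 ≤ d := by exact_mod_cast h
    have : D < d := (ENat.add_one_le_iff (ne_top_of_le_ne_top (ENat.natCast_ne_top d)
      (le_self_add.trans h'))).1 h'
    exact_mod_cast this

end TrivSqZeroExt

/-! ### Comparison with the polynomial ring and the top local cohomology -/

namespace AssocGraded

variable {R : Type*} [CommRing R] {I : Ideal R} {s : ℕ} {x : Fin s → Gr I} {e : Fin s → ℕ}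

/-- The projections of the associated graded ring onto its components. -/
noncomputable def gradedProj (hx : ∀ j, x j ∈ grComponent I (e j)) : Cech.Proj x e (Gr I) where
  π := degreeProj I
  idem := degreeProj_idem
  smul n j z := degreeProj_mul (hx j) n z

/-- The projections of a homogeneous ideal onto its components. -/
noncomputable def idealProj (hx : ∀ j, x j ∈ grComponent I (e j)) (N : Ideal (Gr I))
    (hN : ∀ n : ℤ, ∀ z ∈ N, degreeProj I n z ∈ N) : Cech.Proj x e N where
  π n := ((degreeProj I n).comp N.toAddSubgroup.subtype).codRestrict N.toAddSubgroup
    fun z => hN n z z.2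
  idem n z := Subtype.ext (degreeProj_idem n z.1)
  smul n j z := Subtype.ext (degreeProj_mul (hx j) n z.1)

theorem exists_generators [IsNoetherianRing R] (I : Ideal R) :
    ∃ (s : ℕ) (x : Fin s → Gr I) (e : Fin s → ℕ), (∀ j, x j ∈ grComponent I (e j)) ∧
      Ideal.span (Set.range x) = Cech.irrelevantIdeal (grComponent I) := by
  obtain ⟨s, g, hg⟩ := Submodule.fg_iff_exists_fin_generating_family.1 (IsNoetherian.noetherian I)
  have hgI : ∀ i, g i ∈ I ^ 1 := fun i => by
    rw [pow_one, ← hg]; exact Submodule.subset_span ⟨i, rfl⟩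
  exact ⟨s, fun i => form I 1 (g i) (hgI i), fun _ => 1,
    fun i => mem_component_iff.2 ⟨_, _, rfl⟩, span_range_form hgI hg⟩

end AssocGraded

namespace TrivSqZeroExt

open IsLocalRing AssocGraded

/-- Along `0 → N → G(R) → k[X] → 0`, `H^{d+1}(N) = 0` lifts the nonzero class of degree `-d`, and
`H^d(N) = 0` transfers the vanishing above `-d`. -/
theorem isGreatest_cohomology {A M : Type*} [CommRing A] [IsRegularLocalRing A]
    [AddCommGroup M] [Module A M] [Module Aᵐᵒᵖ M] [IsCentralScalar A M] [Module.Finite A M]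
    {d : ℕ} (hA : ringKrullDim A = d) (hM : Module.supportDim A M < d) {s : ℕ}
    (x : Fin s → Gr (maximalIdeal (TrivSqZeroExt A M))) (e : Fin s → ℕ)
    (hx : ∀ j, x j ∈ grComponent _ (e j))
    (hspan : Ideal.span (Set.range x) = Cech.irrelevantIdeal (grComponent _)) :
    IsGreatest {n : ℤ | Nontrivial (Cech.Cohomology (grComponent _) x e d n)} (-(d : ℤ)) := by
  have hfin : Module.finrank (ResidueField A) (CotangentSpace A) = d := by
    have := (IsRegularLocalRing.iff_finrank_cotangentSpace A).1 inferInstance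
    rw [hA] at this
    exact_mod_cast this
  have hy : ∀ j, gradedFst A M (x j) ∈ grComponent _ (e j) := fun j => by
    rw [mem_component_iff_degreeProj, ← gradedFst_degreeProj,
      mem_component_iff_degreeProj.1 (hx j)]
  have hyspan : Ideal.span (Set.range fun j => gradedFst A M (x j)) =
      Cech.irrelevantIdeal (grComponent (maximalIdeal A)) := by
    have h1 : (Set.range fun j => gradedFst A M (x j)) = gradedFst A M '' Set.range x :=
      Set.range_comp _ _
    rw [h1, ← Ideal.map_span, hspan, Cech.irrelevantIdeal, Ideal.map_span, Cech.irrelevantIdeal]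
    congr 1
    ext z
    constructor
    · rintro ⟨w, ⟨n, hn, hw⟩, rfl⟩
      obtain ⟨a, ha, rfl⟩ := mem_component_iff.1 hw
      exact ⟨n, hn, mem_component_iff.2 ⟨_, _, gradedFst_form _⟩⟩
    · rintro ⟨n, hn, hz⟩
      obtain ⟨a, ha, rfl⟩ := mem_component_iff.1 hz
      exact ⟨_, ⟨n, hn, mem_component_iff.2 ⟨_, _, rfl⟩⟩, gradedFst_form_inl ha⟩
  -- The parameters are extracted from the given generators, so that in the resulting polynomial
  -- ring the images of the `x (c i)` are the variables themselves.
  obtain ⟨g, c, hg1, hg, hgc⟩ := exists_forms_of_generators hfin _ e hy hyspan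
  have hg' : ∀ i, g i ∈ maximalIdeal A := fun i => by simpa using hg1 i
  obtain ⟨φ, hφi, hφ⟩ := exists_ringHom_mvPolynomial hA hg hg'
  have hφs : Function.Surjective φ := fun p => by
    obtain ⟨F, rfl⟩ := MvPolynomial.map_surjective (residue A) residue_surjective p
    exact ⟨_, hφ F⟩
  have hφdeg : ∀ n z, φ (degreeProj _ n z) = MvPolynomial.degreeProj n (φ z) := fun n z => by
    obtain ⟨F, rfl⟩ := polyMap_surjective hg' hg z
    rw [← polyMap_degreeProj, hφ, hφ, MvPolynomial.map_degreeProj]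
  let ψ := φ.comp (gradedFst A M)
  have hψdeg : ∀ n z, ψ (degreeProj _ n z) = MvPolynomial.degreeProj n (ψ z) := fun n z => by
    change φ (gradedFst A M _) = _
    rw [gradedFst_degreeProj, hφdeg]
    rfl
  have hψhom : ∀ {n : ℕ} {z}, z ∈ grComponent _ n → (ψ z).IsHomogeneous n := fun {n z} hz => by
    rw [MvPolynomial.isHomogeneous_iff_degreeProj, ← hψdeg, mem_component_iff_degreeProj.1 hz]
  have hconst : ∀ j, MvPolynomial.constantCoeff (ψ (x j)) = 0 := by
    have h1 : Cech.irrelevantIdeal (grComponent _) ≤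
        RingHom.ker (MvPolynomial.constantCoeff.comp ψ) := by
      refine Ideal.span_le.2 ?_
      rintro z ⟨n, hn, hz⟩
      change MvPolynomial.constantCoeff (ψ z) = 0
      rw [MvPolynomial.constantCoeff_eq]
      by_contra h
      have := (hψhom hz).degree_eq h
      simp at this
      omega
    exact fun j => h1 (hspan ▸ Ideal.subset_span ⟨j, rfl⟩)
  have hX : ∀ i, ∃ j, ψ (x j) = MvPolynomial.X i ∧ e j = 1 := fun i => by
    refine ⟨c i, ?_, (hgc i).1⟩
    change φ (gradedFst A M (x (c i))) = _
    rw [(hgc i).2, ← polyMap_X hg' i, hφ, MvPolynomial.map_X]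
  let hmod : Module (Gr (maximalIdeal (TrivSqZeroExt A M)))
    (MvPolynomial (Fin d) (ResidueField A)) := Module.compHom _ ψ
  have hcoh := Cech.polyProj_cohomology d ψ (fun _ _ => rfl) (fun j => hψhom (hx j)) hconst hX
  set N := RingHom.ker (gradedFst A M) with hN
  have hNdeg : ∀ n : ℤ, ∀ z ∈ N, degreeProj _ n z ∈ N := fun n z hz => by
    rw [hN, RingHom.mem_ker, gradedFst_degreeProj, RingHom.mem_ker.1 hz, map_zero]
  have hdim := supportDim_ker_gradedFst_lt hA hM φ ⟨hφi, hφs⟩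
  have hNv : ∀ n, (idealProj hx N hNdeg).Vanish d n := fun n =>
    (Cech.vanish_of_supportDim_lt x d n N hdim).of_trivial _ n
  have hNv' : ∀ n, (idealProj hx N hNdeg).Vanish (d + 1) n := fun n =>
    (Cech.vanish_of_supportDim_lt x (d + 1) n N (hdim.trans (by
      exact_mod_cast Nat.lt_succ_self d))).of_trivial _ n
  let ψl : Gr (maximalIdeal (TrivSqZeroExt A M)) →ₗ[Gr (maximalIdeal (TrivSqZeroExt A M))]
      MvPolynomial (Fin d) (ResidueField A) :=
    { toFun := ψ, map_add' := map_add ψ, map_smul' := map_mul ψ }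
  have hf : Function.Injective (Submodule.subtype N) := Subtype.val_injective
  have hs : Function.Surjective ψl := hφs.comp gradedFst_surjective
  have hex : Function.Exact (Submodule.subtype N) ψl := fun z => by
    have : ψ z = 0 ↔ z ∈ N := map_eq_zero_iff φ hφi
    exact this.trans (by simp)
  have hP' : ∀ n w, Submodule.subtype N ((idealProj hx N hNdeg).π n w) =
      (gradedProj hx).π (n + 0) (Submodule.subtype N w) := fun n w => by
    rw [add_zero]; rfl
  have hP : ∀ n w, ψl ((gradedProj hx).π n w) =
      (Cech.polyProj ψ (fun _ _ => rfl) (fun j => hψhom (hx j))).π n (ψl w) := hψdeg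
  have hiff := Cech.nontrivial_cohomology_iff (grComponent _) (gradedProj hx)
    (fun m a => mem_component_iff_degreeProj) (fun n hn a => degreeProj_of_neg hn a) d
  constructor
  · refine (hiff _).2 ?_
    have := Cech.Proj.not_vanish_of_surjective hf hs hex hP' hP (hNv' (-d))
      (by rw [add_zero]; exact hcoh.2.2)
    rwa [add_zero] at this
  · intro n hn
    by_contra! hlt
    refine (hiff n).1 hn ?_
    have := Cech.Proj.Vanish.of_exact hf hs hex hP' hP (hNv n)
      (by rw [add_zero]; exact hcoh.2.1 n hlt)
    rwa [add_zero] at this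

theorem isAInvariant {A M : Type*} [CommRing A] [IsRegularLocalRing A]
    [AddCommGroup M] [Module A M] [Module Aᵐᵒᵖ M] [IsCentralScalar A M] [Module.Finite A M]
    {d : ℕ} (hA : ringKrullDim A = d) (hM : Module.supportDim A M < d) :
    IsAInvariant (maximalIdeal (TrivSqZeroExt A M)) (-(d : ℤ)) :=
  ⟨d, ringKrullDim_eq.trans hA, exists_generators _,
    fun _ x e hx hspan => isGreatest_cohomology hA hM x e hx hspan⟩

end TrivSqZeroExt

theorem mainTheorem12 {A M : Type*} [CommRing A] [IsRegularLocalRing A]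
    [AddCommGroup M] [Module A M] [Module Aᵐᵒᵖ M] [IsCentralScalar A M]
    [Module.Finite A M] [Nontrivial M]
    (d : ℕ) (hd : 0 < d) (hA : ringKrullDim A = d) (hM : Module.supportDim A M < d) :
    IsNoetherianRing (TrivSqZeroExt A M) ∧
    ∃ _ : IsLocalRing (TrivSqZeroExt A M),
      (∀ z : TrivSqZeroExt A M, z ∈ IsLocalRing.maximalIdeal (TrivSqZeroExt A M) ↔
        z.fst ∈ IsLocalRing.maximalIdeal A) ∧
      ringKrullDim (TrivSqZeroExt A M) = d ∧
      moduleDepth (TrivSqZeroExt A M) (TrivSqZeroExt A M) =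
        min (moduleDepth A M) (moduleDepth A A) ∧
      min (moduleDepth A M) (moduleDepth A A) < d ∧
      ¬ IsCohenMacaulayLocal (TrivSqZeroExt A M) ∧
      IsAInvariant (IsLocalRing.maximalIdeal (TrivSqZeroExt A M)) (-(d : ℤ)) := by
  have hdA := IsRegularLocalRing.moduleDepth_eq hA
  have hdM : moduleDepth A M < d := by
    have h := (moduleDepth_le_supportDim (R := A) (W := M)).trans_lt hM
    exact_mod_cast h
  have hlt : moduleDepth A M < moduleDepth A A := hdA ▸ hdM
  have hdR := TrivSqZeroExt.moduleDepth_eq hlt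
  have hdim : ringKrullDim (TrivSqZeroExt A M) = d := TrivSqZeroExt.ringKrullDim_eq.trans hA
  refine ⟨inferInstance, inferInstance, fun z => TrivSqZeroExt.mem_maximalIdeal_iff, hdim, ?_, ?_,
    ?_, TrivSqZeroExt.isAInvariant hA hM⟩
  · rw [hdR, min_eq_left hlt.le]
  · rwa [min_eq_left hlt.le]
  · rintro ⟨-, h⟩
    rw [hdR, hdim] at h
    exact hdM.ne (by exact_mod_cast h)
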